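/- Let $k$ be a field of arbitrary characteristic, let $X$ be a scheme of finite type over $k$, and let $X^\circ\subset X$ be the open locus where $X$ is smooth over $k$. Let $\mathcal L(X)$ be the scheme of formal arcs in $X$, whose $k$-points are the $k$-morphisms $\operatorname{Spec} k[[t]]\to X$. Let $\gamma_0:\operatorname{Spec} k[[t]]\to X$ be a $k$-morphism whose image is not contained in $X\setminus X^\circ$, and suppose that $\gamma_0(0)$, the image of the closed point, is not an isolated point of $X$. Then there exist a scheme $Y$ of finite type over $k$ and a point $y\in Y(k)$ such that $$\mathcal L(X)_{\gamma_0}\;\cong\; D^\infty\times Y_y .$$ Here formal neighborhoods are regarded as functors on test-rings, that is, on local commutative $k$-algebras $A$ with residue field $k$ whose maximal ideal $m$ is nilpotent, and $\cong$ means isomorphism of functors: $\mathcal L(X)_{\gamma_0}(A)$ is the set of $k$-morphisms $\operatorname{Spec} A[[t]]\to X$ whose reduction modulo $m$ (that is, restriction to $\operatorname{Spec} k[[t]]$) equals $\gamma_0$; $Y_y$ is the formal neighborhood of $y$ in $Y$, so $Y_y(A)$ is the set of $k$-morphisms $\operatorname{Spec} A\to Y$ whose reduction modulo $m$ equals $y$;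 and $D^\infty$ is the product of countably many (indexed by $\mathbb N$) copies of the formal disk $D=\operatorname{Spf} k[[t]]$, where $D(A)$ is the set of continuous $k$-algebra homomorphisms $k[[t]]\to A$ ($A$ discrete). -/

import Mathlib

open CategoryTheory AlgebraicGeometry

universe u

noncomputable section

namespace FormalArc

/-! ### Test-rings -/

/-- A test-ring over a field `k`: a local commutative `k`-algebra with residue field `k`
(that is, `k → A / m` is bijective) whose maximal ideal `m` is nilpotent. -/
structure IsTestRing (k : Type u) [Field k] (A : Type u) [CommRing A] [Algebra k A] : Prop where
  isLocalRing : IsLocalRing A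
  bijective_residueField :
    Function.Bijective (algebraMap k (IsLocalRing.ResidueField A))
  isNilpotent_maximalIdeal : IsNilpotent (IsLocalRing.maximalIdeal A)

/-- The category of test-rings over `k`; the morphisms are all `k`-algebra homomorphisms. -/
abbrev TestRing (k : Type u) [Field k] : Type (u + 1) :=
  ObjectProperty.FullSubcategory (C := CommAlgCat.{u} k) (fun A => IsTestRing k A)

section Reduction

variable {k : Type u} [Field k]

/-- Reduction modulo the maximal ideal, `A → A / m = k`. -/
def IsTestRing.reduction {A : Type u} [CommRing A] [Algebra k A] (hA : IsTestRing k A) :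
    A →ₐ[k] k :=
  haveI := hA.isLocalRing
  ((AlgEquiv.ofBijective (Algebra.ofId k (IsLocalRing.ResidueField A))
    hA.bijective_residueField).symm : IsLocalRing.ResidueField A →ₐ[k] k).comp
    (IsScalarTower.toAlgHom k A (IsLocalRing.ResidueField A))

/-- A test-ring has only one `k`-algebra homomorphism to `k`, namely the reduction. -/
theorem IsTestRing.algHom_ext {A : Type u} [CommRing A] [Algebra k A] (hA : IsTestRing k A)
    (f g : A →ₐ[k] k) : f = g := by
  have := hA.isLocalRing
  have key : ∀ (h : A →ₐ[k] k) (x : A), x ∈ IsLocalRing.maximalIdeal A → h x = 0 := by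
    intro h x hx
    by_contra hne
    have hu : IsUnit (x - algebraMap k A (h x)) := by
      by_contra hnu
      have h1 : x - algebraMap k A (h x) ∈ IsLocalRing.maximalIdeal A :=
        (IsLocalRing.mem_maximalIdeal _).2 hnu
      have h2 : algebraMap k A (h x) ∈ IsLocalRing.maximalIdeal A := by
        have := Ideal.sub_mem _ hx h1
        simpa using this
      exact (IsLocalRing.mem_maximalIdeal _).1 h2 ((IsUnit.mk0 _ hne).map (algebraMap k A))
    have h3 := hu.map h
    simp at h3
  ext x
  obtain ⟨c, hc⟩ := hA.bijective_residueField.2 (IsLocalRing.residue A x)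
  have hx : x - algebraMap k A c ∈ IsLocalRing.maximalIdeal A := by
    rw [← IsLocalRing.residue_eq_zero_iff, map_sub, sub_eq_zero, ← hc]
    rfl
  have hf := key f _ hx
  have hg := key g _ hx
  simp only [map_sub, AlgHom.commutes, sub_eq_zero] at hf hg
  rw [hf, hg]

/-- Reduction as a morphism of `k`-algebras from a test-ring to `k`. -/
def TestRing.reduction (A : TestRing k) : A.obj ⟶ CommAlgCat.of k k :=
  CommAlgCat.ofHom A.property.reduction

theorem TestRing.comp_reduction {A B : TestRing k} (f : A ⟶ B) :
    f.hom ≫ B.reduction = A.reduction :=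
  CommAlgCat.hom_ext (A.property.algHom_ext _ _)

/-! ### Formal neighbourhoods -/

/-- The formal neighbourhood at a `k`-point `s` of a functor `F` on `k`-algebras, as a functor on
test-rings: its `A`-points are the `A`-points of `F` whose reduction modulo `m` is `s`. -/
def formalNbhd (F : CommAlgCat.{u} k ⥤ Type u) (s : F.obj (CommAlgCat.of k k)) :
    TestRing k ⥤ Type u where
  obj A := {a : F.obj A.obj // F.map A.reduction a = s}
  map {A B} f := TypeCat.ofHom fun a => ⟨F.map f.hom a.1, by
    have h : F.map f.hom ≫ F.map B.reduction = F.map A.reduction := by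
      rw [← F.map_comp, TestRing.comp_reduction]
    exact (ConcreteCategory.congr_hom h a.1).trans a.2⟩
  map_id A := by
    ext a
    simp
  map_comp f g := by
    ext a
    simp

end Reduction

/-! ### Schemes and arcs -/

section Functors

variable (k : Type u) [Field k]

/-- The functor of points of a `k`-scheme on `k`-algebras: `R ↦ X(R)`, the set of
`k`-morphisms `Spec R ⟶ X`. -/
def points (X : Over (Spec (.of k))) : CommAlgCat.{u} k ⥤ Type u :=
  (algSpec (.of k)).rightOp ⋙ yoneda.obj X

/-- The functor `R ↦ R⟦t⟧` on `k`-algebras. -/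
def powerSeries : CommAlgCat.{u} k ⥤ CommAlgCat.{u} k where
  obj R := CommAlgCat.of k (PowerSeries R)
  map f := CommAlgCat.ofHom (PowerSeries.mapAlgHom f.hom)
  map_id R := by
    ext x n
    simp [PowerSeries.mapAlgHom_apply]
  map_comp f g := by
    ext x n
    simp [PowerSeries.mapAlgHom_apply]

/-- The functor of formal arcs in `X`: `R ↦ X(R⟦t⟧)`. Its `k`-points are the `k`-morphisms
`Spec k⟦t⟧ ⟶ X`. -/
def arcs (X : Over (Spec (.of k))) : CommAlgCat.{u} k ⥤ Type u :=
  powerSeries k ⋙ points k X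

variable {k}

/-- The morphism of schemes `Spec k⟦t⟧ ⟶ X` underlying an arc `γ ∈ 𝓛(X)(k)`. -/
def arcHom {X : Over (Spec (.of k))} (γ : (arcs k X).obj (CommAlgCat.of k k)) :
    Spec (.of (PowerSeries k)) ⟶ X.left :=
  CommaMorphism.left (show (algSpec (.of k)).obj (.op (CommAlgCat.of k (PowerSeries k))) ⟶ X from γ)

/-- The point `γ(0)` of `X`: the image of the closed point of `Spec k⟦t⟧`. -/
def arcOrigin {X : Over (Spec (.of k))} (γ : (arcs k X).obj (CommAlgCat.of k k)) : X.left :=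
  arcHom γ (IsLocalRing.closedPoint (PowerSeries k))

/-! ### The formal disk -/

variable (k)

/-- The formal disk `Spf k⟦t⟧`: its `A`-points are the continuous `k`-algebra homomorphisms
from `k⟦t⟧`, with the `t`-adic topology, to the discrete ring `A`, that is, those which
vanish on some power of the ideal `(t)`. -/
def disk : TestRing k ⥤ Type u where
  obj A := {φ : PowerSeries k →ₐ[k] A.obj //
    ∃ n : ℕ, Ideal.span {(PowerSeries.X : PowerSeries k)} ^ n ≤ RingHom.ker φ}
  map {A B} f := TypeCat.ofHom fun φ => ⟨f.hom.hom.comp φ.1, by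
    obtain ⟨n, hn⟩ := φ.2
    refine ⟨n, fun x hx => ?_⟩
    have hx' : φ.1 x = 0 := hn hx
    simp [RingHom.mem_ker, hx']⟩
  map_id A := by
    ext a
    simp
  map_comp f g := by
    ext a
    simp

/-- The product of countably many copies of the formal disk. -/
def diskPow : TestRing k ⥤ Type u where
  obj A := ℕ → (disk k).obj A
  map f := TypeCat.ofHom fun a i => (disk k).map f (a i)
  map_id A := by
    ext a
    simp
  map_comp f g := by
    ext a
    simp

end Functors

end FormalArc

end

/-! In an affine chart around the origin of the arc, X sits in an affine space whose coordinates
split into x (indexed by `τ`) and y (indexed by `ι`). Near the image of the generic point of the arc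
it is cut out by equations p, as many as there are y's, whose Jacobian determinant Δ in the
y-directions does not vanish along γ₀ (`exists_presentation_of_formallySmooth`). Let d be the order
of Δ along γ₀. For a deformation z = (x, y) of γ₀ over a test-ring, Weierstrass preparation writes
Δ(z) as a unit times a unique monic polynomial q of degree d reducing to t ^ d.

Record q, the remainders of x modulo q² and of y modulo q, and the quotients ξ of x by q². This
loses nothing. Once y is known modulo q, one looks for a correction q u; since Δ is q times a unit,
multiplying p = 0 by the adjugate of the Jacobian and dividing by q² gives a fixed-point equation u
= T u, where T is a contraction for the nilpotent ideal of series with coefficients in m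
(`existsUnique_shift_eq_zero`). What is needed is that q divides Δ and p, and q² divides adj · p, at
the remainders; by `sq_dvd_aeval_adjugateMulVec` neither ξ nor the choice of y in its class matters.
Divisibility by a monic polynomial is a system of polynomial equations in finitely many
coefficients, and these equations define Y. `existsUnique_datum` and `existsUnique_arc` are the two
directions of the resulting bijection.

The series ξ are constrained only by their reduction, so each of their coefficients contributes one
formal disk (`existsUnique_disk`). There are countably infinitely many coefficients unless `τ` is
empty; in that case the Jacobian is invertible in all directions at the generic point of the arc,
which makes γ₀(0) isolated (`isOpen_singleton_of_isEmpty`). -/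

namespace FormalArc

/-! ### Generalities -/

/-- Two functors to types are isomorphic as soon as there is a relation between their values,
compatible with the morphisms, which is everywhere the graph of a bijection. -/
theorem nonempty_iso_of_relation {C : Type*} [Category C] {F G : C ⥤ Type u}
    (R : ∀ A : C, F.obj A → G.obj A → Prop)
    (map : ∀ ⦃A B : C⦄ (f : A ⟶ B) (a : F.obj A) (b : G.obj A),
      R A a b → R B (F.map f a) (G.map f b))
    (left : ∀ A a, ∃! b, R A a b) (right : ∀ A b, ∃! a, R A a b) : Nonempty (F ≅ G) := by
  choose g hg hg' using left
  choose f hf hf' using right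
  refine ⟨NatIso.ofComponents (fun A => Equiv.toIso
    ⟨g A, f A, fun a => (hf' A _ a (hg A a)).symm, fun b => (hg' A _ b (hf A b)).symm⟩) ?_⟩
  intro A B φ
  ext a
  exact (hg' B (F.map φ a) _ (map φ a _ (hg A a))).symm

/-- A contraction for the adic topology of a nilpotent ideal has a unique fixed point. -/
theorem existsUnique_fixedPoint {S ι : Type*} [CommRing S] {M : Ideal S} (hM : IsNilpotent M)
    (T : (ι → S) → ι → S) (hT : ∀ u, (∀ i, u i ∈ M) → ∀ i, T u i ∈ M)
    (hc : ∀ n u v, (∀ i, u i ∈ M) → (∀ i, v i ∈ M) → (∀ i, u i - v i ∈ M ^ n) →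
      ∀ i, T u i - T v i ∈ M ^ (n + 1)) :
    ∃! u : ι → S, (∀ i, u i ∈ M) ∧ T u = u := by
  obtain ⟨e, he⟩ := hM
  have hit : ∀ n i, (T^[n] 0) i ∈ M := by
    intro n
    induction n with
    | zero => intro i; simp
    | succ n ih =>
      rw [Function.iterate_succ_apply']
      exact hT _ ih
  have hstep : ∀ n i, (T^[n + 1] 0) i - (T^[n] 0) i ∈ M ^ n := by
    intro n
    induction n with
    | zero => intro i; simp
    | succ n ih =>
      rw [Function.iterate_succ_apply', Function.iterate_succ_apply' T n]
      exact hc n _ _ (Function.iterate_succ_apply' T n 0 ▸ hit (n + 1)) (hit n)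
        (Function.iterate_succ_apply' T n 0 ▸ ih)
  -- Consecutive iterates agree modulo M ^ n after n steps, and M ^ e = 0, so the iteration from 0
  -- is stationary from step e on.
  refine ⟨T^[e] 0, ⟨hit e, ?_⟩, ?_⟩
  · funext i
    have := hstep e i
    rw [he, Function.iterate_succ_apply'] at this
    exact sub_eq_zero.1 (by simpa using this)
  · rintro v ⟨hv, hTv⟩
    have : ∀ n i, v i - (T^[e] 0) i ∈ M ^ n := by
      intro n
      induction n with
      | zero => simp
      | succ n ih =>
        intro i
        have h1 := hc n _ _ hv (hit e) ih i
        have h2 : T (T^[e] 0) i = (T^[e] 0) i := by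
          have := hstep e i
          rw [he, Function.iterate_succ_apply'] at this
          exact sub_eq_zero.1 (by simpa using this)
        rwa [hTv, h2] at h1
    funext i
    have := this e i
    rw [he] at this
    exact sub_eq_zero.1 (by simpa using this)

open MvPolynomial in
/-- The second order Taylor formula, as a congruence. -/
theorem aeval_add_mul_sub_aeval_add_mul {k σ S : Type*} [CommRing k] [CommRing S] [Algebra k S]
    [Fintype σ] (p : MvPolynomial σ k) (y u v : σ → S) (q : S) (K L : Ideal S)
    (hu : ∀ j, u j ∈ K) (hv : ∀ j, v j ∈ K) (huv : ∀ j, u j - v j ∈ L) :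
    ∃ R ∈ K * L, aeval (fun j => y j + q * u j) p - aeval (fun j => y j + q * v j) p =
      q * ∑ j, aeval y (pderiv j p) * (u j - v j) + q ^ 2 * R := by
  classical
  -- When the induction below multiplies p by a variable, the value at y + q v enters times q (u i -
  -- v i), so it is needed only to first order.
  have hfirst : ∀ p : MvPolynomial σ k, ∃ E ∈ K,
      aeval (fun j => y j + q * v j) p - aeval y p = q * E := by
    intro p
    induction p using MvPolynomial.induction_on with
    | C a => exact ⟨0, K.zero_mem, by simp⟩
    | add p₁ p₂ h₁ h₂ =>
      obtain ⟨E₁, hE₁, h₁⟩ := h₁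
      obtain ⟨E₂, hE₂, h₂⟩ := h₂
      exact ⟨E₁ + E₂, K.add_mem hE₁ hE₂, by simp only [map_add]; linear_combination h₁ + h₂⟩
    | mul_X p i h =>
      obtain ⟨E, hE, h⟩ := h
      refine ⟨E * (y i + q * v i) + aeval y p * v i,
        K.add_mem (K.mul_mem_right _ hE) (K.mul_mem_left _ (hv i)), ?_⟩
      simp only [map_mul, aeval_X]
      linear_combination (y i + q * v i) * h
  induction p using MvPolynomial.induction_on with
  | C a => exact ⟨0, zero_mem _, by simp⟩
  | add p₁ p₂ h₁ h₂ =>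
    obtain ⟨R₁, hR₁, h₁⟩ := h₁
    obtain ⟨R₂, hR₂, h₂⟩ := h₂
    refine ⟨R₁ + R₂, add_mem hR₁ hR₂, ?_⟩
    simp only [map_add, add_mul, Finset.sum_add_distrib]
    linear_combination h₁ + h₂
  | mul_X p i h =>
    obtain ⟨R, hR, h⟩ := h
    obtain ⟨E, hE, hE'⟩ := hfirst p
    refine ⟨(∑ j, aeval y (pderiv j p) * (u j - v j)) * u i + R * (y i + q * u i) +
      E * (u i - v i), ?_, ?_⟩
    · refine add_mem (add_mem ?_ (Ideal.mul_mem_right _ _ hR)) (Ideal.mul_mem_mul hE (huv i))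
      rw [mul_comm (∑ j, _)]
      exact Ideal.mul_mem_mul (hu i) (Ideal.sum_mem _ fun j _ => Ideal.mul_mem_left _ _ (huv j))
    · have hs : ∑ j, aeval y (pderiv j (p * X i)) * (u j - v j) =
          (∑ j, aeval y (pderiv j p) * (u j - v j)) * y i + aeval y p * (u i - v i) := by
        simp only [pderiv_mul, pderiv_X, map_add, map_mul, aeval_X, add_mul,
          Finset.sum_add_distrib, Finset.sum_mul]
        congr 1
        · exact Finset.sum_congr rfl fun j _ => by ring
        · rw [Finset.sum_eq_single i]
          · simp
          · intro j _ hj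
            simp [hj.symm]
          · simp
      rw [hs]
      simp only [map_mul, aeval_X]
      linear_combination (y i + q * u i) * h + q * (u i - v i) * hE'

open MvPolynomial in
/-- Polynomial functions respect congruences. -/
theorem aeval_sub_aeval_mem {k σ S : Type*} [CommRing k] [CommRing S] [Algebra k S]
    (p : MvPolynomial σ k) {y z : σ → S} {J : Ideal S} (h : ∀ j, y j - z j ∈ J) :
    aeval y p - aeval z p ∈ J := by
  rw [← Ideal.Quotient.eq, ← Ideal.Quotient.mkₐ_eq_mk k, ← AlgHom.comp_apply, ← AlgHom.comp_apply,
    comp_aeval, comp_aeval]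
  congr 3
  funext j
  exact Ideal.Quotient.eq.2 (h j)

/-! ### Power series over test-rings -/

namespace IsTestRing

variable {k : Type u} [Field k] {A : Type u} [CommRing A] [Algebra k A]

theorem reduction_eq_zero_iff (hA : IsTestRing k A) [IsLocalRing A] {x : A} :
    hA.reduction x = 0 ↔ x ∈ IsLocalRing.maximalIdeal A := by
  rw [← IsLocalRing.residue_eq_zero_iff]
  exact (AlgEquiv.ofBijective (Algebra.ofId k (IsLocalRing.ResidueField A))
    hA.bijective_residueField).symm.map_eq_zero_iff

theorem isUnit_of_reduction (hA : IsTestRing k A) {x : A} (h : hA.reduction x ≠ 0) : IsUnit x := by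
  have := hA.isLocalRing
  exact not_not.1 fun hx => h (hA.reduction_eq_zero_iff.2 hx)

theorem isNilpotent_ker (hA : IsTestRing k A) : IsNilpotent (RingHom.ker hA.reduction) := by
  have := hA.isLocalRing
  convert hA.isNilpotent_maximalIdeal
  ext x
  exact hA.reduction_eq_zero_iff

/-- Reduction of power series modulo the maximal ideal. -/
noncomputable def mapReduction (hA : IsTestRing k A) : PowerSeries A →ₐ[k] PowerSeries k :=
  PowerSeries.mapAlgHom hA.reduction

/-- The power series whose coefficients lie in the maximal ideal form a nilpotent ideal. -/
theorem isNilpotent_ker_mapReduction (hA : IsTestRing k A) :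
    IsNilpotent (RingHom.ker hA.mapReduction) := by
  obtain ⟨e, he⟩ := hA.isNilpotent_ker
  have key : ∀ n, ∀ f ∈ RingHom.ker hA.mapReduction ^ n,
      ∀ i, PowerSeries.coeff i f ∈ RingHom.ker hA.reduction ^ n := by
    intro n
    induction n with
    | zero => simp
    | succ n ih =>
      intro f hf
      rw [pow_succ] at hf
      refine Submodule.mul_induction_on hf (fun a ha b hb i => ?_) fun a b ha hb i => ?_
      · rw [PowerSeries.coeff_mul, pow_succ]
        refine Ideal.sum_mem _ fun c _ => Ideal.mul_mem_mul (ih a ha _) ?_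
        have := congrArg (PowerSeries.coeff c.2) (RingHom.mem_ker.1 hb)
        simpa [mapReduction, PowerSeries.mapAlgHom_apply] using this
      · rw [map_add]
        exact add_mem (ha i) (hb i)
  refine ⟨e, eq_bot_iff.2 fun f hf => ?_⟩
  ext i
  simpa [he] using key e f hf i

theorem isUnit_of_mapReduction (hA : IsTestRing k A) {f : PowerSeries A}
    (h : IsUnit (hA.mapReduction f)) : IsUnit f := by
  rw [PowerSeries.isUnit_iff_constantCoeff] at h ⊢
  refine hA.isUnit_of_reduction ?_
  have h0 := h.ne_zero
  rwa [mapReduction, PowerSeries.mapAlgHom_apply, ← PowerSeries.coeff_zero_eq_constantCoeff_apply,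
    PowerSeries.coeff_map, PowerSeries.coeff_zero_eq_constantCoeff_apply] at h0

/-- Completeness is automatic for a nilpotent ideal; it is what Weierstrass division and preparation
require. -/
theorem isAdicComplete (hA : IsTestRing k A) [IsLocalRing A] :
    IsAdicComplete (IsLocalRing.maximalIdeal A) A := by
  obtain ⟨e, he⟩ := hA.isNilpotent_maximalIdeal
  refine { haus' := fun x hx => ?_, prec' := fun f hf => ⟨f e, fun n => ?_⟩ }
  · have := hx e
    rw [SModEq.zero, smul_eq_mul, Ideal.mul_top] at this
    rw [he] at this
    simpa using this
  · rcases le_total n e with h | h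
    · exact hf h
    · have := hf h
      rw [SModEq.sub_mem, smul_eq_mul, Ideal.mul_top] at this
      rw [he] at this
      have h0 : f e - f n = 0 := by
        simpa using this
      rw [sub_eq_zero.1 h0]

/-- A monic polynomial reducing to `X ^ d` modulo the maximal ideal. -/
structure IsDistinguished (hA : IsTestRing k A) (d : ℕ) (q : Polynomial A) : Prop where
  monic : q.Monic
  natDegree : q.natDegree = d
  map_eq : q.map (hA.reduction : A →+* k) = Polynomial.X ^ d

namespace IsDistinguished

variable {hA : IsTestRing k A} {d : ℕ} {q : Polynomial A}

theorem pow (hq : hA.IsDistinguished d q) (n : ℕ) : hA.IsDistinguished (n * d) (q ^ n) where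
  monic := hq.monic.pow n
  natDegree := by rw [hq.monic.natDegree_pow, hq.natDegree]
  map_eq := by rw [Polynomial.map_pow, hq.map_eq, ← pow_mul, mul_comm]

theorem isDistinguishedAt (hq : hA.IsDistinguished d q) [IsLocalRing A] :
    q.IsDistinguishedAt (IsLocalRing.maximalIdeal A) where
  mem {n} hn := by
    rw [hq.natDegree] at hn
    rw [← hA.reduction_eq_zero_iff]
    have := congrArg (Polynomial.coeff · n) hq.map_eq
    simpa [Polynomial.coeff_X_pow, hn.ne] using this
  monic := hq.monic

theorem mapReduction_coe (hq : hA.IsDistinguished d q) :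
    hA.mapReduction (q : PowerSeries A) = PowerSeries.X ^ d := by
  rw [mapReduction, PowerSeries.mapAlgHom_apply]
  rw [← Polynomial.polynomial_map_coe, hq.map_eq]
  simp

/-- Weierstrass division bounds the remainder by this order; here the bound becomes d. -/
theorem order_eq (hq : hA.IsDistinguished d q) [IsLocalRing A] :
    ((q : PowerSeries A).map (Ideal.Quotient.mk (IsLocalRing.maximalIdeal A))).order.toNat
      = d := by
  have h := hq.isDistinguishedAt.coe_natDegree_eq_order_map q 1
    (by simp) (by simp)
  rw [← hq.natDegree, ← h]
  rfl

theorem exists_division (hq : hA.IsDistinguished d q) (g : PowerSeries A) :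
    ∃ (h : PowerSeries A) (r : Polynomial A), r.degree < d ∧ g = q * h + r := by
  have := hA.isLocalRing
  have := hA.isAdicComplete
  have hd := hq.isDistinguishedAt.isWeierstrassDivisorAt'
  have := hd.isWeierstrassDivisionAt_div_mod g
  exact ⟨_, _, hq.order_eq ▸ this.degree_lt, this.eq_mul_add⟩

theorem division_unique (hq : hA.IsDistinguished d q) {h h' : PowerSeries A} {r r' : Polynomial A}
    (hr : r.degree < d) (hr' : r'.degree < d)
    (heq : (q * h + r : PowerSeries A) = q * h' + r') : h = h' ∧ r = r' := by
  have := hA.isLocalRing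
  have := hA.isAdicComplete
  have hd := hq.isDistinguishedAt.isWeierstrassDivisorAt'
  exact hd.eq_of_mul_add_eq_mul_add (hq.order_eq.symm ▸ hr) (hq.order_eq.symm ▸ hr') heq

theorem mul_left_cancel (hq : hA.IsDistinguished d q) {h h' : PowerSeries A}
    (heq : (q * h : PowerSeries A) = q * h') : h = h' :=
  (hq.division_unique (r := 0) (r' := 0) (by simp) (by simp) (by simpa using heq)).1

/-- By uniqueness of Weierstrass division, Euclidean division by q is also the division in power
series. This turns divisibility of series into finitely many equations on coefficients, which is why
the parameter scheme can be of finite type. -/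
theorem dvd_coe_iff (hq : hA.IsDistinguished d q) (f : Polynomial A) :
    (q : PowerSeries A) ∣ f ↔ f %ₘ q = 0 := by
  have := hA.isLocalRing
  have hdeg : q.degree = d := by
    rw [Polynomial.degree_eq_natDegree hq.monic.ne_zero, hq.natDegree]
  constructor
  · rintro ⟨h, hh⟩
    refine (hq.division_unique (h := (f /ₘ q : Polynomial A)) (h' := h) (r' := 0)
      (hdeg ▸ Polynomial.degree_modByMonic_lt _ hq.monic) (by simp) ?_).2
    rw [Polynomial.coe_zero, add_zero, ← hh, ← Polynomial.coe_mul, ← Polynomial.coe_add,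
      add_comm, Polynomial.modByMonic_add_div]
  · intro h
    obtain ⟨g, rfl⟩ := (Polynomial.modByMonic_eq_zero_iff_dvd hq.monic).1 h
    exact ⟨g, by simp⟩

end IsDistinguished

/-- Weierstrass preparation over test-rings. -/
theorem existsUnique_isDistinguished_dvd (hA : IsTestRing k A) {d : ℕ} {f : PowerSeries A}
    {v : PowerSeries k} (hv : IsUnit v) (hf : hA.mapReduction f = PowerSeries.X ^ d * v) :
    ∃! q : Polynomial A, hA.IsDistinguished d q ∧ (q : PowerSeries A) ∣ f := by
  have := hA.isLocalRing
  have := hA.isAdicComplete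
  -- The cofactor is automatically a unit: cancelling t ^ d after reduction shows that it reduces to
  -- v.
  have hfac : ∀ (q : Polynomial A) h, hA.IsDistinguished d q → f = q * h →
      f.IsWeierstrassFactorization q h := by
    intro q h hq hh
    refine ⟨hq.isDistinguishedAt, hA.isUnit_of_mapReduction ?_, hh⟩
    rw [hh, map_mul, hq.mapReduction_coe] at hf
    rwa [mul_left_cancel₀ (pow_ne_zero _ PowerSeries.X_ne_zero) hf]
  have hne : f.map (IsLocalRing.residue A) ≠ 0 := by
    intro h0
    refine mul_ne_zero (pow_ne_zero d PowerSeries.X_ne_zero) hv.ne_zero (hf.symm.trans ?_)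
    ext i
    have := congrArg (PowerSeries.coeff i) h0
    rw [PowerSeries.coeff_map, map_zero, IsLocalRing.residue_eq_zero_iff,
      ← hA.reduction_eq_zero_iff] at this
    simpa [mapReduction, PowerSeries.mapAlgHom_apply] using this
  obtain ⟨q, h, H⟩ := f.exists_isWeierstrassFactorization hne
  have hq : hA.IsDistinguished q.natDegree q := by
    refine ⟨H.isDistinguishedAt.monic, rfl, ?_⟩
    ext i
    rw [Polynomial.coeff_map, Polynomial.coeff_X_pow]
    split_ifs with hi
    · subst hi
      have : q.coeff q.natDegree = 1 := H.isDistinguishedAt.monic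
      simp [this]
    · rcases lt_or_gt_of_ne hi with hi | hi
      · exact hA.reduction_eq_zero_iff.2 (H.isDistinguishedAt.mem hi)
      · rw [Polynomial.coeff_eq_zero_of_natDegree_lt hi, map_zero]
  have hd : q.natDegree = d := by
    have h1 : (PowerSeries.X ^ d * v : PowerSeries k) =
        PowerSeries.X ^ q.natDegree * hA.mapReduction h := by
      rw [← hf, H.eq_mul, map_mul, hq.mapReduction_coe]
    have h2 : IsUnit (hA.mapReduction h) := H.isUnit.map _
    have h3 : (PowerSeries.X ^ d : PowerSeries k) ∣ PowerSeries.X ^ q.natDegree :=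
      h2.dvd_mul_right.1 ⟨v, h1.symm⟩
    have h4 : (PowerSeries.X ^ q.natDegree : PowerSeries k) ∣ PowerSeries.X ^ d :=
      hv.dvd_mul_right.1 ⟨_, h1⟩
    rw [pow_dvd_pow_iff PowerSeries.X_ne_zero PowerSeries.X_prime.not_isUnit] at h3 h4
    exact le_antisymm h4 h3
  refine ⟨q, ⟨hd ▸ hq, ⟨h, H.eq_mul⟩⟩, ?_⟩
  rintro q' ⟨hq', h', hh'⟩
  exact ((hfac q' h' hq' hh').elim H).1

theorem isUnit_of_eq_mul (hA : IsTestRing k A) {d : ℕ} {q : Polynomial A}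
    (hq : hA.IsDistinguished d q) {f g : PowerSeries A} {v : PowerSeries k} (hv : IsUnit v)
    (hf : hA.mapReduction f = PowerSeries.X ^ d * v) (h : f = q * g) : IsUnit g := by
  refine hA.isUnit_of_mapReduction ?_
  rw [h, map_mul, hq.mapReduction_coe] at hf
  rwa [mul_left_cancel₀ (pow_ne_zero _ PowerSeries.X_ne_zero) hf]

/-- A power series with nonzero reduction is not a zero divisor. -/
theorem eq_zero_of_mul_eq_zero (hA : IsTestRing k A) {f g : PowerSeries A}
    (hf : hA.mapReduction f ≠ 0) (h : f * g = 0) : g = 0 := by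
  have hv := PowerSeries.isUnit_divided_by_X_pow_order hf
  have hf' := (PowerSeries.X_pow_order_mul_divXPowOrder (f := hA.mapReduction f)).symm
  -- Preparation splits the series into a distinguished polynomial, cancellable by uniqueness of
  -- division, and a unit.
  obtain ⟨q, ⟨hq, v, rfl⟩, -⟩ := hA.existsUnique_isDistinguished_dvd hv hf'
  have h1 : v * g = 0 := hq.mul_left_cancel (by rw [mul_zero, ← mul_assoc, h])
  exact (hA.isUnit_of_eq_mul hq hv hf' rfl).mul_right_eq_zero.1 h1

/-! ### Points of the formal disk -/

theorem disk_apply_X_mem (hA : IsTestRing k A) (φ : PowerSeries k →ₐ[k] A)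
    (hφ : ∃ n : ℕ, Ideal.span {(PowerSeries.X : PowerSeries k)} ^ n ≤ RingHom.ker φ) :
    hA.reduction (φ PowerSeries.X) = 0 := by
  obtain ⟨n, hn⟩ := hφ
  have : φ (PowerSeries.X ^ n) = 0 := hn (Ideal.pow_mem_pow (Ideal.mem_span_singleton_self _) n)
  rw [map_pow] at this
  have h := congrArg hA.reduction this
  rw [map_pow, map_zero] at h
  exact eq_zero_of_pow_eq_zero h

/-- Thus the formal disk has m as its set of points. Since a ^ e = 0 for some e, evaluating the
truncation at order e is multiplicative; continuity forces every other homomorphism to be given by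
truncation too. -/
theorem existsUnique_disk (hA : IsTestRing k A) {a : A} (ha : hA.reduction a = 0) :
    ∃! φ : {φ : PowerSeries k →ₐ[k] A //
      ∃ n : ℕ, Ideal.span {(PowerSeries.X : PowerSeries k)} ^ n ≤ RingHom.ker φ},
      φ.1 PowerSeries.X = a := by
  have happly : ∀ (φ : PowerSeries k →ₐ[k] A) (n : ℕ),
      Ideal.span {(PowerSeries.X : PowerSeries k)} ^ n ≤ RingHom.ker φ →
      ∀ f, φ f = Polynomial.aeval (φ PowerSeries.X) (PowerSeries.trunc n f) := by
    intro φ n hn f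
    have h1 : φ (PowerSeries.X ^ n) = 0 :=
      hn (Ideal.pow_mem_pow (Ideal.mem_span_singleton_self _) n)
    have h2 : ∀ p : Polynomial k, Polynomial.aeval (φ PowerSeries.X) p = φ p := by
      intro p
      have : (Polynomial.aeval (φ PowerSeries.X) : Polynomial k →ₐ[k] A) =
          φ.comp (Polynomial.coeToPowerSeries.algHom k) := by
        ext
        simp
      rw [this]
      simp
    rw [h2]
    conv_lhs => rw [f.eq_X_pow_mul_shift_add_trunc n]
    rw [map_add, map_mul, h1, zero_mul, zero_add]
  obtain ⟨e, he⟩ := hA.isNilpotent_ker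
  have hae : a ^ e = 0 := by
    have := Ideal.pow_mem_pow (RingHom.mem_ker.2 ha) e
    rwa [he] at this
  have htr : ∀ p : Polynomial k, Polynomial.aeval a (PowerSeries.trunc e (p : PowerSeries k)) =
      Polynomial.aeval a p := by
    intro p
    obtain ⟨r, hr⟩ : Polynomial.X ^ e ∣ p - PowerSeries.trunc e (p : PowerSeries k) := by
      rw [Polynomial.X_pow_dvd_iff]
      intro d hd
      simp [PowerSeries.coeff_trunc, hd]
    have := congrArg (Polynomial.aeval a) hr
    rw [map_mul, map_pow, Polynomial.aeval_X, hae, zero_mul, map_sub, sub_eq_zero] at this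
    exact this.symm
  let φ : PowerSeries k →ₐ[k] A :=
    { toFun := fun f => Polynomial.aeval a (PowerSeries.trunc e f)
      map_one' := by
        rw [← Polynomial.coe_one, htr, map_one]
      map_mul' := fun f g => by
        rw [← PowerSeries.trunc_trunc_mul_trunc, ← Polynomial.coe_mul, htr, map_mul]
      map_zero' := by simp
      map_add' := fun f g => by simp
      commutes' := fun c => by
        have : algebraMap k (PowerSeries k) c =
            ((Polynomial.C c : Polynomial k) : PowerSeries k) := by
          simp
        rw [this, htr, Polynomial.aeval_C] }
  refine ⟨⟨φ, e, ?_⟩, ?_, ?_⟩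
  · rw [Ideal.span_singleton_pow, Ideal.span_singleton_le_iff_mem, RingHom.mem_ker]
    change Polynomial.aeval a (PowerSeries.trunc e (PowerSeries.X ^ e)) = 0
    have : (PowerSeries.X ^ e : PowerSeries k) =
        ((Polynomial.X ^ e : Polynomial k) : PowerSeries k) := by
      simp
    rw [this, htr, map_pow, Polynomial.aeval_X, hae]
  · change Polynomial.aeval a (PowerSeries.trunc e PowerSeries.X) = a
    rw [← Polynomial.coe_X, htr, Polynomial.aeval_X]
  · rintro ⟨ψ, n, hn⟩ hψ
    ext f
    change ψ f = Polynomial.aeval a (PowerSeries.trunc e f)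
    -- The order n at which ψ vanishes may exceed e, so the two truncations are compared at `max n
    -- e`.
    have hne : ∀ m, n ≤ m → ψ f = Polynomial.aeval a (PowerSeries.trunc m f) := by
      intro m hm
      rw [happly ψ m ((Ideal.pow_le_pow_right hm).trans hn) f, hψ]
    rw [hne (max n e) (le_max_left _ _), ← htr, PowerSeries.trunc_trunc_of_le f (le_max_right _ _)]

end IsTestRing

/-! ### Newton's method for a system of equations with invertible partial Jacobian -/

section Newton

variable {k τ ι S : Type*} [CommRing k] [Fintype ι] [CommRing S] [Algebra k S]

/-- Move a point by a multiple of `q` in the coordinates indexed by `ι`. -/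
def shift (z : τ ⊕ ι → S) (q : S) (u : ι → S) : τ ⊕ ι → S :=
  Sum.elim (fun t => z (Sum.inl t)) fun i => z (Sum.inr i) + q * u i

theorem aeval_shift_sub_aeval_shift [Fintype τ] (g : MvPolynomial (τ ⊕ ι) k) (z : τ ⊕ ι → S) (q : S)
    (u v : ι → S) (K L : Ideal S)
    (hu : ∀ j, u j ∈ K) (hv : ∀ j, v j ∈ K) (huv : ∀ j, u j - v j ∈ L) :
    ∃ R ∈ K * L, MvPolynomial.aeval (shift z q u) g - MvPolynomial.aeval (shift z q v) g =
      q * ∑ j, MvPolynomial.aeval z (MvPolynomial.pderiv (Sum.inr j) g) * (u j - v j) +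
        q ^ 2 * R := by
  have hs : ∀ u : ι → S, shift z q u =
      fun j => z j + q * (Sum.elim (fun _ => 0) u : τ ⊕ ι → S) j := by
    intro u
    ext (t | i) <;> simp [shift]
  obtain ⟨R, hR, h⟩ := aeval_add_mul_sub_aeval_add_mul g z (Sum.elim (fun _ => 0) u)
    (Sum.elim (fun _ => 0) v) q K L (by rintro (t | i) <;> simp [hu])
    (by rintro (t | i) <;> simp [hv]) (by rintro (t | i) <;> simp [huv])
  refine ⟨R, hR, ?_⟩
  rw [hs, hs, h, Fintype.sum_sum_type]
  simp

theorem aeval_shift_sub_aeval [Fintype τ] (g : MvPolynomial (τ ⊕ ι) k) (z : τ ⊕ ι → S) (q : S)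
    (u : ι → S) :
    ∃ R, MvPolynomial.aeval (shift z q u) g - MvPolynomial.aeval z g =
      q * ∑ j, MvPolynomial.aeval z (MvPolynomial.pderiv (Sum.inr j) g) * u j + q ^ 2 * R := by
  obtain ⟨R, -, h⟩ := aeval_shift_sub_aeval_shift g z q u 0 ⊤ ⊤ (by simp) (by simp) (by simp)
  have h0 : shift z q 0 = z := by
    ext (t | i) <;> simp [shift]
  exact ⟨R, by simpa [h0] using h⟩

variable [DecidableEq ι] (p : ι → MvPolynomial (τ ⊕ ι) k)

/-- The matrix of partial derivatives with respect to the variables indexed by `ι`. -/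
noncomputable def jacobian : Matrix ι ι (MvPolynomial (τ ⊕ ι) k) :=
  Matrix.of fun i j => MvPolynomial.pderiv (Sum.inr j) (p i)

/-- The product of the adjugate of the partial Jacobian matrix with the vector of equations. -/
noncomputable def adjugateMulVec : ι → MvPolynomial (τ ⊕ ι) k :=
  (jacobian p).adjugate.mulVec p

theorem aeval_adjugateMulVec (z : τ ⊕ ι → S) (i : ι) :
    MvPolynomial.aeval z (adjugateMulVec p i) =
      ∑ j, MvPolynomial.aeval z ((jacobian p).adjugate i j) * MvPolynomial.aeval z (p j) := by
  simp [adjugateMulVec, Matrix.mulVec, dotProduct]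

theorem sum_adjugate_mul_sum_jacobian (z : τ ⊕ ι → S) (u : ι → S) (i : ι) :
    ∑ j, MvPolynomial.aeval z ((jacobian p).adjugate i j) *
      ∑ l, MvPolynomial.aeval z (jacobian p j l) * u l =
      MvPolynomial.aeval z (jacobian p).det * u i := by
  have h := (jacobian p).adjugate_mul
  have h2 : ((jacobian p).adjugate.map (MvPolynomial.aeval z)).mulVec
      (((jacobian p).map (MvPolynomial.aeval z)).mulVec u) =
      MvPolynomial.aeval z (jacobian p).det • u := by
    rw [Matrix.mulVec_mulVec, ← Matrix.map_mul, h]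
    ext i
    simp [Matrix.mulVec, dotProduct, Matrix.one_apply, apply_ite, ite_mul]
  exact congrFun h2 i

theorem sum_jacobian_mul_sum_adjugate (z : τ ⊕ ι → S) (u : ι → S) (i : ι) :
    ∑ j, MvPolynomial.aeval z (jacobian p i j) *
      ∑ l, MvPolynomial.aeval z ((jacobian p).adjugate j l) * u l =
      MvPolynomial.aeval z (jacobian p).det * u i := by
  have h := (jacobian p).mul_adjugate
  have h2 : ((jacobian p).map (MvPolynomial.aeval z)).mulVec
      (((jacobian p).adjugate.map (MvPolynomial.aeval z)).mulVec u) =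
      MvPolynomial.aeval z (jacobian p).det • u := by
    rw [Matrix.mulVec_mulVec, ← Matrix.map_mul, h]
    ext i
    simp [Matrix.mulVec, dotProduct, Matrix.one_apply, apply_ite, ite_mul]
  exact congrFun h2 i

/-- The divisibility of `adjugateMulVec` by `q ^ 2` only depends on the coordinates indexed by `τ`
modulo `q ^ 2` and on those indexed by `ι` modulo `q`. -/
theorem sq_dvd_aeval_adjugateMulVec [Fintype τ] {q : S} {z z' : τ ⊕ ι → S}
    (hτ : ∀ t, q ^ 2 ∣ z' (Sum.inl t) - z (Sum.inl t))
    (hι : ∀ i, q ∣ z' (Sum.inr i) - z (Sum.inr i))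
    (hdet : q ∣ MvPolynomial.aeval z (jacobian p).det)
    (hp : ∀ i, q ∣ MvPolynomial.aeval z (p i))
    (h : ∀ i, q ^ 2 ∣ MvPolynomial.aeval z (adjugateMulVec p i)) (i : ι) :
    q ^ 2 ∣ MvPolynomial.aeval z' (adjugateMulVec p i) := by
  choose u hu using hι
  -- An intermediate point: moving the `τ`-coordinates first changes nothing modulo q², and then
  -- only a shift by q u in the `ι`-coordinates remains.
  let y : τ ⊕ ι → S := Sum.elim (fun t => z' (Sum.inl t)) fun i => z (Sum.inr i)
  have hz' : z' = shift y q u := by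
    ext (t | i)
    · simp [shift, y]
    · simp only [shift, y, Sum.elim_inr, ← hu]
      ring
  have hy : ∀ g : MvPolynomial (τ ⊕ ι) k,
      q ^ 2 ∣ MvPolynomial.aeval y g - MvPolynomial.aeval z g := by
    intro g
    rw [← Ideal.mem_span_singleton]
    refine aeval_sub_aeval_mem g ?_
    rintro (t | i)
    · exact Ideal.mem_span_singleton.2 (hτ t)
    · simp [y]
  have hq2 : q ∣ q ^ 2 := dvd_pow_self q two_ne_zero
  have hdet' : q ∣ MvPolynomial.aeval y (jacobian p).det :=
    (dvd_iff_dvd_of_dvd_sub (hq2.trans (hy _))).2 hdet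
  have hp' : ∀ i, q ∣ MvPolynomial.aeval y (p i) := fun i =>
    (dvd_iff_dvd_of_dvd_sub (hq2.trans (hy _))).2 (hp i)
  have h' : q ^ 2 ∣ MvPolynomial.aeval y (adjugateMulVec p i) :=
    (dvd_iff_dvd_of_dvd_sub (hy _)).2 (h i)
  have hadj : ∀ j, ∃ E, MvPolynomial.aeval z' ((jacobian p).adjugate i j) =
      MvPolynomial.aeval y ((jacobian p).adjugate i j) + q * E := by
    intro j
    obtain ⟨R, hR⟩ := aeval_shift_sub_aeval ((jacobian p).adjugate i j) y q u
    rw [hz']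
    exact ⟨_, by rw [sub_eq_iff_eq_add.1 hR, sq, mul_assoc, ← mul_add, add_comm]⟩
  choose E hE using hadj
  have hpz : ∀ j, ∃ R, MvPolynomial.aeval z' (p j) = MvPolynomial.aeval y (p j) +
      q * ∑ l, MvPolynomial.aeval y (jacobian p j l) * u l + q ^ 2 * R := by
    intro j
    obtain ⟨R, hR⟩ := aeval_shift_sub_aeval (p j) y q u
    exact ⟨R, by rw [hz', add_assoc, add_comm, ← sub_eq_iff_eq_add, hR]; rfl⟩
  choose R hR using hpz
  -- The first-order change of p, multiplied by the adjugate, is q · det · u, and q divides det. The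
  -- change of the adjugate itself is a multiple of q and multiplies p, which q divides as well. So
  -- everything is trivial modulo q².
  have key : MvPolynomial.aeval z' (adjugateMulVec p i) =
      MvPolynomial.aeval y (adjugateMulVec p i) + q * (MvPolynomial.aeval y (jacobian p).det * u i)
      + ∑ j, (q * E j * MvPolynomial.aeval y (p j) +
        q ^ 2 * (E j * ∑ l, MvPolynomial.aeval y (jacobian p j l) * u l) +
        q ^ 2 * (MvPolynomial.aeval z' ((jacobian p).adjugate i j) * R j)) := by
    rw [← sum_adjugate_mul_sum_jacobian, aeval_adjugateMulVec, aeval_adjugateMulVec,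
      Finset.mul_sum, ← Finset.sum_add_distrib, ← Finset.sum_add_distrib]
    refine Finset.sum_congr rfl fun j _ => ?_
    rw [hR j]
    linear_combination (MvPolynomial.aeval y (p j) +
      q * ∑ l, MvPolynomial.aeval y (jacobian p j l) * u l) * hE j
  rw [key]
  refine dvd_add (dvd_add h' ?_) (Finset.dvd_sum fun j _ => dvd_add (dvd_add ?_ ?_) ?_)
  · rw [sq]
    exact mul_dvd_mul_left q (hdet'.mul_right _)
  · rw [sq, mul_assoc]
    exact mul_dvd_mul_left q ((hp' j).mul_left _)
  · exact dvd_mul_right _ _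
  · exact dvd_mul_right _ _

/-- Newton's lemma: an approximate solution is congruent, modulo `q` times a nilpotent ideal, to a
unique solution. -/
theorem existsUnique_shift_eq_zero [Fintype τ] {M : Ideal S} (hM : IsNilpotent M) {q : S}
    (hq : ∀ a b : S, q * a = q * b → a = b) {z : τ ⊕ ι → S} {v : S} (hv : IsUnit v)
    (hdet : MvPolynomial.aeval z (jacobian p).det = q * v) {a : ι → S} (ha : ∀ i, a i ∈ M)
    (h : ∀ i, MvPolynomial.aeval z (adjugateMulVec p i) = q ^ 2 * a i) :
    ∃! u : ι → S, (∀ i, u i ∈ M) ∧ ∀ i, MvPolynomial.aeval (shift z q u) (p i) = 0 := by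
  obtain ⟨v, rfl⟩ := hv
  have hq2 : ∀ a b : S, q ^ 2 * a = q ^ 2 * b → a = b := fun a b hab =>
    hq _ _ (hq _ _ (by linear_combination hab))
  choose R hR using fun (u : ι → S) (j : ι) => aeval_shift_sub_aeval (p j) z q u
  have hRsub : ∀ (K L : Ideal S) (u u' : ι → S), (∀ i, u i ∈ K) → (∀ i, u' i ∈ K) →
      (∀ i, u i - u' i ∈ L) → ∀ j, R u j - R u' j ∈ K * L := by
    intro K L u u' hu hu' huu' j
    obtain ⟨R', hR', h'⟩ := aeval_shift_sub_aeval_shift (p j) z q u u' K L hu hu' huu'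
    convert hR'
    refine hq2 _ _ ?_
    simp only [mul_sub, Finset.sum_sub_distrib] at h'
    linear_combination h' - hR u j + hR u' j
  have hR0 : ∀ j, R 0 j = 0 := by
    intro j
    refine hq2 _ _ ?_
    have h0 : shift z q 0 = z := by
      ext (t | i) <;> simp [shift]
    simpa [h0] using (hR 0 j).symm
  -- After multiplication by the adjugate, the Taylor expansion of p at the shifted point is q² (a +
  -- v u + adj · R(u)); T solves for the linear occurrence of u.
  let T : (ι → S) → ι → S := fun u i =>
    -(↑v⁻¹ * (a i + ∑ j, MvPolynomial.aeval z ((jacobian p).adjugate i j) * R u j))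
  have hadj : ∀ (u : ι → S) (i : ι), ∑ j, MvPolynomial.aeval z ((jacobian p).adjugate i j) *
      MvPolynomial.aeval (shift z q u) (p j) = q ^ 2 * (v * (u i - T u i)) := by
    intro u i
    have h1 : ∑ j, MvPolynomial.aeval z ((jacobian p).adjugate i j) *
        MvPolynomial.aeval (shift z q u) (p j) = MvPolynomial.aeval z (adjugateMulVec p i) +
        q * (MvPolynomial.aeval z (jacobian p).det * u i) +
        q ^ 2 * ∑ j, MvPolynomial.aeval z ((jacobian p).adjugate i j) * R u j := by
      rw [← sum_adjugate_mul_sum_jacobian, aeval_adjugateMulVec, Finset.mul_sum, Finset.mul_sum,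
        ← Finset.sum_add_distrib, ← Finset.sum_add_distrib]
      refine Finset.sum_congr rfl fun j _ => ?_
      rw [sub_eq_iff_eq_add.1 (hR u j)]
      simp only [jacobian, Matrix.of_apply]
      ring
    rw [h1, h, hdet]
    simp only [T, sub_neg_eq_add, mul_add, Units.mul_inv_cancel_left]
    ring
  have hfix : ∀ u : ι → S, (∀ i, MvPolynomial.aeval (shift z q u) (p i) = 0) ↔ T u = u := by
    intro u
    constructor
    · intro hu
      funext i
      have := hadj u i
      simp only [hu, mul_zero, Finset.sum_const_zero] at this
      have h1 := hq2 0 (v * (u i - T u i)) (by rw [mul_zero]; exact this)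
      exact (sub_eq_zero.1 (v.isUnit.mul_right_eq_zero.1 h1.symm)).symm
    -- A fixed point only kills adj · p; multiplying by the Jacobian gives q v p = 0, and both q and
    -- v cancel.
    · intro hu i
      have h1 := sum_jacobian_mul_sum_adjugate p z
        (fun j => MvPolynomial.aeval (shift z q u) (p j)) i
      simp only [hadj, hu, sub_self, mul_zero, Finset.sum_const_zero, hdet] at h1
      have h2 := hq 0 (v * MvPolynomial.aeval (shift z q u) (p i))
        (by rw [mul_zero, h1, mul_assoc])
      exact v.isUnit.mul_right_eq_zero.1 h2.symm
  -- The contraction comes from the quadratic remainder: its variation lies in M * M ^ n.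
  have hTsub : ∀ (n : ℕ) (u u' : ι → S), (∀ i, u i ∈ M) → (∀ i, u' i ∈ M) →
      (∀ i, u i - u' i ∈ M ^ n) → ∀ i, T u i - T u' i ∈ M ^ (n + 1) := by
    intro n u u' hu hu' huu' i
    have h1 : T u i - T u' i = -(↑v⁻¹ * ∑ j, MvPolynomial.aeval z ((jacobian p).adjugate i j) *
        (R u j - R u' j)) := by
      simp only [T, mul_sub, Finset.sum_sub_distrib]
      ring
    rw [h1, pow_succ']
    exact neg_mem (Ideal.mul_mem_left _ _ (Ideal.sum_mem _ fun j _ =>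
      Ideal.mul_mem_left _ _ (hRsub M (M ^ n) u u' hu hu' huu' j)))
  have hT : ∀ u, (∀ i, u i ∈ M) → ∀ i, T u i ∈ M := by
    intro u hu i
    have h1 := hTsub 0 u 0 hu (by simp) (by simp) i
    have h2 : T 0 i ∈ M := by
      simp only [T, hR0, mul_zero, Finset.sum_const_zero, add_zero]
      exact neg_mem (Ideal.mul_mem_left _ _ (ha i))
    rw [zero_add, pow_one] at h1
    simpa using add_mem h1 h2
  simp only [hfix]
  exact existsUnique_fixedPoint hM T hT hTsub

end Newton

/-! ### Finite-dimensional data attached to an arc -/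

section Data

/-- The polynomial of degree less than `n` with given coefficients. -/
noncomputable def ofCoeffs {A : Type*} [CommRing A] {n : ℕ} (c : Fin n → A) : Polynomial A :=
  ∑ i, Polynomial.C (c i) * Polynomial.X ^ (i : ℕ)

theorem degree_ofCoeffs_lt {A : Type*} [CommRing A] {n : ℕ} (c : Fin n → A) :
    (ofCoeffs c).degree < n := by
  refine (Polynomial.degree_sum_le _ _).trans_lt ((Finset.sup_lt_iff (WithBot.bot_lt_coe n)).2 ?_)
  intro i _
  exact (Polynomial.degree_C_mul_X_pow_le _ _).trans_lt (Nat.cast_lt.2 i.2)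

theorem coeff_ofCoeffs {A : Type*} [CommRing A] {n : ℕ} (c : Fin n → A) (i : Fin n) :
    (ofCoeffs c).coeff i = c i := by
  simp [ofCoeffs, Polynomial.coeff_X_pow, Fin.val_inj]

theorem ofCoeffs_injective {A : Type*} [CommRing A] {n : ℕ} :
    Function.Injective (ofCoeffs : (Fin n → A) → Polynomial A) := fun c c' h => by
  funext i
  rw [← coeff_ofCoeffs c, h, coeff_ofCoeffs]

theorem exists_ofCoeffs {A : Type*} [CommRing A] {n : ℕ} {r : Polynomial A} (hr : r.degree < n) :
    ∃ c : Fin n → A, ofCoeffs c = r := by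
  refine ⟨fun i => r.coeff i, ?_⟩
  ext j
  rcases lt_or_ge j n with h | h
  · exact coeff_ofCoeffs _ ⟨j, h⟩
  · rw [Polynomial.coeff_eq_zero_of_degree_lt
        ((degree_ofCoeffs_lt _).trans_le (by exact_mod_cast h)),
      Polynomial.coeff_eq_zero_of_degree_lt (hr.trans_le (by exact_mod_cast h))]

theorem map_ofCoeffs {A B : Type*} [CommRing A] [CommRing B] (f : A →+* B) {n : ℕ} (c : Fin n → A) :
    (ofCoeffs c).map f = ofCoeffs fun i => f (c i) := by
  simp [ofCoeffs, Polynomial.map_sum]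

variable (τ ι : Type) (d : ℕ)

/-- The indices of the coefficients of a monic polynomial `q` of degree `d`, of polynomials of
degree less than `2 * d` indexed by `τ`, and of polynomials of degree less than `d` indexed
by `ι`. -/
abbrev CoeffIndex : Type := Fin d ⊕ (τ × Fin (2 * d)) ⊕ (ι × Fin d)

variable {τ ι d} {A : Type*} [CommRing A]

/-- The monic polynomial of degree `d` encoded in the data. -/
noncomputable def monicPart (w : CoeffIndex τ ι d → A) : Polynomial A :=
  Polynomial.X ^ d + ofCoeffs fun i => w (Sum.inl i)

/-- The polynomials indexed by `τ ⊕ ι` encoded in the data. -/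
noncomputable def coordPart (w : CoeffIndex τ ι d → A) : τ ⊕ ι → Polynomial A :=
  Sum.elim (fun t => ofCoeffs fun i => w (Sum.inr (Sum.inl (t, i))))
    fun j => ofCoeffs fun i => w (Sum.inr (Sum.inr (j, i)))

theorem degree_coordPart_inl (w : CoeffIndex τ ι d → A) (t : τ) :
    (coordPart w (Sum.inl t)).degree < (2 * d : ℕ) := degree_ofCoeffs_lt _

theorem degree_coordPart_inr (w : CoeffIndex τ ι d → A) (i : ι) :
    (coordPart w (Sum.inr i)).degree < d := degree_ofCoeffs_lt _

theorem monicPart_monic (w : CoeffIndex τ ι d → A) : (monicPart w).Monic :=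
  Polynomial.monic_X_pow_add (degree_ofCoeffs_lt _)

theorem map_monicPart {B : Type*} [CommRing B] (f : A →+* B) (w : CoeffIndex τ ι d → A) :
    (monicPart w).map f = monicPart fun i => f (w i) := by
  simp [monicPart, map_ofCoeffs]

theorem map_coordPart {B : Type*} [CommRing B] (f : A →+* B) (w : CoeffIndex τ ι d → A)
    (j : τ ⊕ ι) : (coordPart w j).map f = coordPart (fun i => f (w i)) j := by
  rcases j with t | j <;> simp [coordPart, map_ofCoeffs]

theorem eq_of_parts_eq {w w' : CoeffIndex τ ι d → A} (h : monicPart w = monicPart w')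
    (h' : ∀ j, coordPart w j = coordPart w' j) : w = w' := by
  funext i
  rcases i with i | ⟨t, i⟩ | ⟨j, i⟩
  · exact congrFun (ofCoeffs_injective (add_left_cancel h)) i
  · exact congrFun (ofCoeffs_injective (h' (Sum.inl t))) i
  · exact congrFun (ofCoeffs_injective (h' (Sum.inr j))) i

theorem exists_parts_eq {q : Polynomial A} (hq : q.Monic) (hd : q.natDegree = d)
    {x : τ → Polynomial A} (hx : ∀ t, (x t).degree < (2 * d : ℕ)) {y : ι → Polynomial A}
    (hy : ∀ i, (y i).degree < d) :
    ∃ w : CoeffIndex τ ι d → A, monicPart w = q ∧ coordPart w = Sum.elim x y := by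
  have hqd : (q - Polynomial.X ^ d).degree < (d : WithBot ℕ) := by
    rcases subsingleton_or_nontrivial A with hA | hA
    · rw [Subsingleton.elim (q - Polynomial.X ^ d) 0, Polynomial.degree_zero]
      exact WithBot.bot_lt_coe d
    have h1 : q.degree = d := by rw [Polynomial.degree_eq_natDegree hq.ne_zero, hd]
    rw [← h1]
    refine Polynomial.degree_sub_lt_left ?_ hq.ne_zero ?_
    · rw [h1, Polynomial.degree_X_pow]
    · rw [hq, (Polynomial.monic_X_pow d).leadingCoeff]
  obtain ⟨c, hc⟩ := exists_ofCoeffs hqd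
  choose cx hcx using fun t => exists_ofCoeffs (hx t)
  choose cy hcy using fun i => exists_ofCoeffs (hy i)
  refine ⟨Sum.elim c (Sum.elim (fun a => cx a.1 a.2) fun a => cy a.1 a.2), ?_, ?_⟩
  · simp [monicPart, hc]
  · ext1 (t | i)
    · simp [coordPart, hcx]
    · simp [coordPart, hcy]

end Data

theorem coe_aeval {k σ A : Type*} [CommRing k] [CommRing A] [Algebra k A]
    (y : σ → Polynomial A) (g : MvPolynomial σ k) :
    ((MvPolynomial.aeval y g : Polynomial A) : PowerSeries A) =
      MvPolynomial.aeval (fun j => (y j : PowerSeries A)) g :=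
  MvPolynomial.comp_aeval_apply y ((Polynomial.coeToPowerSeries.algHom A).restrictScalars k) g

/-- Polynomial functions respect congruences, and an arc agrees with its remainders modulo q in
every coordinate. Conditions modulo q can thus be tested on either. -/
theorem dvd_aeval_sub_aeval_coordPart {k A : Type*} {τ ι : Type} [CommRing k] [CommRing A]
    [Algebra k A]
    {d : ℕ}
    {z : τ ⊕ ι → PowerSeries A} {ξ : τ → PowerSeries A} {w : CoeffIndex τ ι d → A}
    (hinl : ∀ t, z (Sum.inl t) = coordPart w (Sum.inl t) + (monicPart w : PowerSeries A) ^ 2 * ξ t)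
    (hinr : ∀ i, (monicPart w : PowerSeries A) ∣ z (Sum.inr i) - coordPart w (Sum.inr i))
    (g : MvPolynomial (τ ⊕ ι) k) :
    (monicPart w : PowerSeries A) ∣ MvPolynomial.aeval z g -
      MvPolynomial.aeval (fun j => (coordPart w j : PowerSeries A)) g := by
  rw [← Ideal.mem_span_singleton]
  refine aeval_sub_aeval_mem g ?_
  rintro (t | i) <;> rw [Ideal.mem_span_singleton]
  · rw [hinl, add_sub_cancel_left, sq, mul_assoc]
    exact dvd_mul_right _ _
  · exact hinr i

/-- Monicity and degree are built into the encoding, so only the reduction of the data has to be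
controlled. -/
theorem IsTestRing.IsDistinguished.monicPart {k : Type u} [Field k] {A : Type u} [CommRing A]
    [Algebra k A] (hA : IsTestRing k A) {τ ι : Type} {d : ℕ} {w : CoeffIndex τ ι d → A}
    (hw : (monicPart fun i => hA.reduction (w i)) = (Polynomial.X ^ d : Polynomial k)) :
    hA.IsDistinguished d (monicPart w) where
  monic := monicPart_monic w
  natDegree := by
    have := hA.isLocalRing
    rw [FormalArc.monicPart, Polynomial.natDegree_add_eq_left_of_degree_lt,
      Polynomial.natDegree_X_pow]
    rw [Polynomial.degree_X_pow]
    exact degree_ofCoeffs_lt _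
  map_eq := (map_monicPart _ w).trans hw

/-! ### Arcs and their data -/

section Correspondence

variable {k : Type u} [Field k] {τ ι : Type} [Fintype ι] [DecidableEq ι]
  (p : ι → MvPolynomial (τ ⊕ ι) k) (d : ℕ)

/-- The equations satisfied by the data attached to an arc. -/
structure IsDatum {A : Type*} [CommRing A] [Algebra k A] (w : CoeffIndex τ ι d → A) : Prop where
  det : MvPolynomial.aeval (coordPart w) (jacobian p).det %ₘ monicPart w = 0
  eqn : ∀ i, MvPolynomial.aeval (coordPart w) (p i) %ₘ monicPart w = 0
  adj : ∀ i, MvPolynomial.aeval (coordPart w) (adjugateMulVec p i) %ₘ monicPart w ^ 2 = 0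

/-- The relation between an arc `z`, the quotients `ξ` and the data `w`. -/
structure IsDatumOf {A : Type*} [CommRing A] [Algebra k A] (z : τ ⊕ ι → PowerSeries A)
    (ξ : τ → PowerSeries A) (w : CoeffIndex τ ι d → A) : Prop where
  det : (monicPart w : PowerSeries A) ∣ MvPolynomial.aeval z (jacobian p).det
  inl : ∀ t, z (Sum.inl t) = coordPart w (Sum.inl t) + (monicPart w : PowerSeries A) ^ 2 * ξ t
  inr : ∀ i, (monicPart w : PowerSeries A) ∣ z (Sum.inr i) - coordPart w (Sum.inr i)

variable {p d}

/-- Serves twice: for naturality of the final isomorphism, and, applied to the reduction, for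
comparing the data of a deformation with those of γ₀. -/
theorem IsDatumOf.map {A B : Type*} [CommRing A] [Algebra k A] [CommRing B] [Algebra k B]
    {z : τ ⊕ ι → PowerSeries A} {ξ : τ → PowerSeries A} {w : CoeffIndex τ ι d → A}
    (h : IsDatumOf p d z ξ w) (f : A →ₐ[k] B) :
    IsDatumOf p d (fun j => PowerSeries.mapAlgHom f (z j))
      (fun t => PowerSeries.mapAlgHom f (ξ t)) fun i => f (w i) := by
  have hco : ∀ P : Polynomial A, PowerSeries.mapAlgHom f (P : PowerSeries A) =
      ((P.map (f : A →+* B) : Polynomial B) : PowerSeries B) := fun P => by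
    rw [PowerSeries.mapAlgHom_apply, Polynomial.polynomial_map_coe]
  have hm : PowerSeries.mapAlgHom f (monicPart w : PowerSeries A) =
      (monicPart fun i => f (w i) : Polynomial B) := by
    rw [hco, map_monicPart]
    rfl
  have hc : ∀ j, PowerSeries.mapAlgHom f (coordPart w j : PowerSeries A) =
      (coordPart (fun i => f (w i)) j : Polynomial B) := fun j => by
    rw [hco, map_coordPart]
    rfl
  refine ⟨?_, fun t => ?_, fun i => ?_⟩
  · rw [← hm]
    have := map_dvd (PowerSeries.mapAlgHom f) h.det
    rwa [MvPolynomial.comp_aeval_apply] at this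
  · rw [h.inl, map_add, map_mul, map_pow, hm, hc]
  · rw [← hm, ← hc, ← map_sub]
    exact map_dvd _ (h.inr i)

variable {A : Type u} [CommRing A] [Algebra k A]

/-- At the arc itself p = 0 and q divides the determinant. These facts pass to the remainders by
congruence modulo q, and for adj · p modulo q² by `sq_dvd_aeval_adjugateMulVec`. -/
theorem IsDatumOf.isDatum [Fintype τ] (hA : IsTestRing k A) {z : τ ⊕ ι → PowerSeries A}
    {ξ : τ → PowerSeries A} {w : CoeffIndex τ ι d → A} (h : IsDatumOf p d z ξ w)
    (hw : hA.IsDistinguished d (monicPart w)) (hz : ∀ i, MvPolynomial.aeval z (p i) = 0) :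
    IsDatum p d w := by
  have hsub := dvd_aeval_sub_aeval_coordPart (k := k) h.inl h.inr
  refine ⟨?_, fun i => ?_, fun i => ?_⟩
  · rw [← hw.dvd_coe_iff, coe_aeval]
    exact (dvd_iff_dvd_of_dvd_sub (hsub _)).1 h.det
  · rw [← hw.dvd_coe_iff, coe_aeval]
    refine (dvd_iff_dvd_of_dvd_sub (hsub _)).1 ?_
    rw [hz]
    exact dvd_zero _
  · rw [← (hw.pow 2).dvd_coe_iff, coe_aeval, Polynomial.coe_pow]
    refine sq_dvd_aeval_adjugateMulVec p (z := z) (fun t => ?_) (fun i => ?_) h.det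
      (fun i => ?_) (fun i => ?_) i
    · rw [h.inl, sub_add_cancel_left, dvd_neg]
      exact dvd_mul_right _ _
    · rw [dvd_sub_comm]
      exact h.inr i
    · rw [hz]
      exact dvd_zero _
    · rw [aeval_adjugateMulVec]
      simp [hz]

/-- Weierstrass preparation of the determinant forces q, and then division by q² and by q forces the
rest. The quotients of the `ι`-coordinates are dropped, because Newton's lemma recovers them. -/
theorem existsUnique_datum (hA : IsTestRing k A) {z : τ ⊕ ι → PowerSeries A}
    {v : PowerSeries k} (hv : IsUnit v)
    (hz : hA.mapReduction (MvPolynomial.aeval z (jacobian p).det) = PowerSeries.X ^ d * v) :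
    ∃! ξw : (τ → PowerSeries A) × (CoeffIndex τ ι d → A),
      hA.IsDistinguished d (monicPart ξw.2) ∧ IsDatumOf p d z ξw.1 ξw.2 := by
  obtain ⟨q, ⟨hq, hdvd⟩, huniq⟩ := hA.existsUnique_isDistinguished_dvd hv hz
  choose ξ x hx hξ using fun t => (hq.pow 2).exists_division (z (Sum.inl t))
  choose η y hy hη using fun i => hq.exists_division (z (Sum.inr i))
  obtain ⟨w, hwq, hwc⟩ := exists_parts_eq hq.monic hq.natDegree hx hy
  refine ⟨(ξ, w), ⟨hwq ▸ hq, ?_, fun t => ?_, fun i => ?_⟩, ?_⟩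
  · rwa [hwq]
  · simp only [hwq, hwc, Sum.elim_inl]
    rw [hξ t, Polynomial.coe_pow, add_comm]
  · simp only [hwq, hwc, Sum.elim_inr]
    rw [hη i]
    simp
  · rintro ⟨ξ', w'⟩ ⟨hw', h'⟩
    have hq' : monicPart w' = q := huniq _ ⟨hw', h'.det⟩
    have hl : ∀ t, ξ' t = ξ t ∧ coordPart w' (Sum.inl t) = x t := by
      intro t
      refine (hq.pow 2).division_unique (degree_coordPart_inl w' t) (hx t) ?_
      rw [← hξ t, h'.inl t, hq', Polynomial.coe_pow, add_comm]
    have hr : ∀ i, coordPart w' (Sum.inr i) = y i := by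
      intro i
      obtain ⟨c, hc⟩ := h'.inr i
      refine (hq.division_unique (h := c) (h' := η i) (degree_coordPart_inr w' i) (hy i) ?_).2
      rw [← hη i, sub_eq_iff_eq_add.1 hc, hq']
    refine Prod.ext (funext fun t => (hl t).1) (eq_of_parts_eq (hq'.trans hwq.symm) ?_)
    rw [hwc]
    rintro (t | i)
    · exact (hl t).2
    · exact hr i

/-- The data prescribe the `τ`-coordinates exactly and the `ι`-coordinates modulo q. Any completion
reducing to γ₀ is an approximate solution, which Newton's lemma corrects in a unique way. -/
theorem existsUnique_arc [Fintype τ] (hA : IsTestRing k A) {z₀ : τ ⊕ ι → PowerSeries k}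
    (hz₀ : ∀ i, MvPolynomial.aeval z₀ (p i) = 0) {v : PowerSeries k} (hv : IsUnit v)
    (hdet : MvPolynomial.aeval z₀ (jacobian p).det = PowerSeries.X ^ d * v)
    {ξ₀ : τ → PowerSeries k} {w₀ : CoeffIndex τ ι d → k}
    (h₀ : monicPart w₀ = Polynomial.X ^ d) (h₀' : IsDatumOf p d z₀ ξ₀ w₀)
    {ξ : τ → PowerSeries A} (hξ : ∀ t, hA.mapReduction (ξ t) = ξ₀ t)
    {w : CoeffIndex τ ι d → A} (hw : ∀ i, hA.reduction (w i) = w₀ i) (h : IsDatum p d w) :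
    ∃! z : τ ⊕ ι → PowerSeries A, (∀ j, hA.mapReduction (z j) = z₀ j) ∧
      (∀ i, MvPolynomial.aeval z (p i) = 0) ∧ IsDatumOf p d z ξ w := by
  have hq : hA.IsDistinguished d (monicPart w) :=
    IsTestRing.IsDistinguished.monicPart hA (by rw [← h₀]; congr; exact funext hw)
  have hred : ∀ (z : τ ⊕ ι → PowerSeries A), (∀ j, hA.mapReduction (z j) = z₀ j) →
      ∀ g : MvPolynomial (τ ⊕ ι) k,
        hA.mapReduction (MvPolynomial.aeval z g) = MvPolynomial.aeval z₀ g := by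
    intro z hz g
    rw [MvPolynomial.comp_aeval_apply]
    congr 2
    exact funext hz
  have hcoord : ∀ j, hA.mapReduction (coordPart w j : PowerSeries A) = coordPart w₀ j := by
    intro j
    rw [IsTestRing.mapReduction, PowerSeries.mapAlgHom_apply, ← Polynomial.polynomial_map_coe,
      map_coordPart]
    congr 2
    exact funext hw
  choose ω hω using h₀'.inr
  rw [h₀, Polynomial.coe_pow, Polynomial.coe_X] at hω
  -- The quotients ω of the `ι`-coordinates of γ₀ are extended by constants, so that the approximate
  -- solution `z₁` reduces to γ₀.
  let lift : PowerSeries k →ₐ[k] PowerSeries A := PowerSeries.mapAlgHom (Algebra.ofId k A)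
  have hlift : ∀ f, hA.mapReduction (lift f) = f := by
    intro f
    ext n
    simp [lift, IsTestRing.mapReduction, PowerSeries.mapAlgHom_apply]
  let y : τ ⊕ ι → PowerSeries A := fun j => coordPart w j
  let q : PowerSeries A := monicPart w
  let z₁ : τ ⊕ ι → PowerSeries A := Sum.elim (fun t => y (Sum.inl t) + q ^ 2 * ξ t)
    fun i => y (Sum.inr i) + q * lift (ω i)
  have hz₁ : ∀ j, hA.mapReduction (z₁ j) = z₀ j := by
    rintro (t | i)
    · have := h₀'.inl t
      rw [h₀, Polynomial.coe_pow, Polynomial.coe_X] at this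
      simp only [z₁, Sum.elim_inl, map_add, map_mul, map_pow, y, q, hcoord, hq.mapReduction_coe, hξ,
        this]
    · simp only [z₁, Sum.elim_inr, map_add, map_mul, y, q, hcoord, hq.mapReduction_coe, hlift,
        ← hω i, add_sub_cancel]
  have hinl : ∀ t, q ^ 2 ∣ z₁ (Sum.inl t) - y (Sum.inl t) := fun t => by simp [z₁]
  have hinr : ∀ i, q ∣ z₁ (Sum.inr i) - y (Sum.inr i) := fun i => by simp [z₁]
  have hdety : q ∣ MvPolynomial.aeval y (jacobian p).det := by
    rw [← coe_aeval, hq.dvd_coe_iff]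
    exact h.det
  have hadj : ∀ i, q ^ 2 ∣ MvPolynomial.aeval z₁ (adjugateMulVec p i) := by
    refine sq_dvd_aeval_adjugateMulVec p (z := y) hinl hinr hdety (fun i => ?_) fun i => ?_
    · rw [← coe_aeval, hq.dvd_coe_iff]
      exact h.eqn i
    · rw [← coe_aeval, ← Polynomial.coe_pow, (hq.pow 2).dvd_coe_iff]
      exact h.adj i
  have hdet₁ : q ∣ MvPolynomial.aeval z₁ (jacobian p).det :=
    (dvd_iff_dvd_of_dvd_sub (dvd_aeval_sub_aeval_coordPart (ξ := ξ) (fun t => rfl) hinr _)).2 hdety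
  obtain ⟨v₁, hv₁⟩ := hdet₁
  have hv₁u : IsUnit v₁ := hA.isUnit_of_eq_mul hq hv ((hred z₁ hz₁ _).trans hdet) hv₁
  choose a ha using hadj
  -- Modulo m, adj · p is evaluated on γ₀ and vanishes, while q² becomes a nonzero power of t.
  have haM : ∀ i, a i ∈ RingHom.ker hA.mapReduction := by
    intro i
    have h1 := hred z₁ hz₁ (adjugateMulVec p i)
    rw [ha, map_mul, map_pow, hq.mapReduction_coe, aeval_adjugateMulVec] at h1
    simp only [hz₀, mul_zero, Finset.sum_const_zero] at h1
    exact (mul_eq_zero.1 h1).resolve_left (pow_ne_zero _ (pow_ne_zero _ PowerSeries.X_ne_zero))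
  obtain ⟨u, ⟨huM, hu⟩, huniq⟩ := existsUnique_shift_eq_zero p hA.isNilpotent_ker_mapReduction
    (fun a b => hq.mul_left_cancel) hv₁u hv₁ haM ha
  refine ⟨shift z₁ q u, ⟨?_, hu, ?_, ?_, ?_⟩, ?_⟩
  · rintro (t | i)
    · exact hz₁ (Sum.inl t)
    · simp only [shift, Sum.elim_inr, map_add, map_mul, RingHom.mem_ker.1 (huM i), mul_zero,
        add_zero, hz₁]
  · refine (dvd_iff_dvd_of_dvd_sub
      (dvd_aeval_sub_aeval_coordPart (ξ := ξ) (fun t => rfl) ?_ _)).2 hdety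
    intro i
    simp only [shift, Sum.elim_inr, z₁, y, add_assoc, add_sub_cancel_left, ← mul_add]
    exact dvd_mul_right _ _
  · exact fun t => rfl
  · intro i
    simp only [shift, Sum.elim_inr, z₁, y, add_assoc, add_sub_cancel_left, ← mul_add]
    exact dvd_mul_right _ _
  · rintro z ⟨hz, hpz, hdz⟩
    choose η hη using hdz.inr
    -- Every competitor is a shift of `z₁`, with coefficients that reduce to 0; uniqueness in
    -- Newton's lemma then applies.
    have hzs : z = shift z₁ q fun i => η i - lift (ω i) := by
      ext1 (t | i)
      · exact hdz.inl t
      · simp only [shift, Sum.elim_inr, z₁]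
        linear_combination hη i
    have hηu : (fun i => η i - lift (ω i)) = u := by
      refine huniq _ ⟨fun i => ?_, fun i => ?_⟩
      swap
      · rw [← hzs]
        exact hpz i
      rw [RingHom.mem_ker, map_sub, hlift, sub_eq_zero]
      have h1 := congrArg hA.mapReduction (hη i)
      rw [map_sub, hz, hcoord, hω, map_mul, hq.mapReduction_coe] at h1
      exact (mul_left_cancel₀ (pow_ne_zero _ PowerSeries.X_ne_zero) h1).symm
    rw [hzs, hηu]

end Correspondence

/-! ### The affine case -/

section Functors

variable {k : Type u} [Field k]

theorem isTestRing_self : IsTestRing k k where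
  isLocalRing := inferInstance
  bijective_residueField :=
    ⟨(algebraMap k (IsLocalRing.ResidueField k)).injective, IsLocalRing.residue_surjective⟩
  isNilpotent_maximalIdeal := by
    rw [IsLocalRing.maximalIdeal_eq_bot]
    exact IsNilpotent.zero

/-- A transformation of functors which is injective, and bijective near the point under
consideration, is an isomorphism on formal neighbourhoods. -/
theorem nonempty_formalNbhd_iso {F G : CommAlgCat.{u} k ⥤ Type u} (e : F ⟶ G)
    (hinj : ∀ A, Function.Injective (e.app A))
    (s : F.obj (CommAlgCat.of k k)) (s' : G.obj (CommAlgCat.of k k)) (h : e.app _ s = s')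
    (hsurj : ∀ (A : TestRing k) (b : G.obj A.obj), G.map A.reduction b = s' →
      ∃ a, e.app A.obj a = b) :
    Nonempty (formalNbhd F s ≅ formalNbhd G s') := by
  subst h
  have hnat : ∀ {A B : CommAlgCat.{u} k} (f : A ⟶ B) (a : F.obj A),
      G.map f (e.app A a) = e.app B (F.map f a) :=
    fun f a => (NatTrans.naturality_apply e f a).symm
  refine nonempty_iso_of_relation (fun A a b => e.app A.obj a.1 = b.1) ?_ ?_ ?_
  · intro A B f a b h
    refine (hnat f.hom a.1).symm.trans ?_
    rw [h]
    rfl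
  · intro A a
    exact ⟨⟨e.app A.obj a.1, by rw [hnat, a.2]⟩, rfl, fun b hb => Subtype.ext hb.symm⟩
  · rintro A ⟨b, hb⟩
    obtain ⟨a, rfl⟩ := hsurj A b hb
    exact ⟨⟨a, hinj _ ((hnat _ _).symm.trans hb)⟩, rfl, fun a' ha' => Subtype.ext (hinj _ ha')⟩

/-- The functor on `k`-algebras corepresented by a `k`-algebra. -/
abbrev homs (B : Type u) [CommRing B] [Algebra k B] : CommAlgCat.{u} k ⥤ Type u :=
  coyoneda.obj (.op (CommAlgCat.of k B))

theorem map_aeval_coordPart {τ ι : Type} {d : ℕ} {A : Type*} [CommRing A] [Algebra k A]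
    (w : CoeffIndex τ ι d → A) (g : MvPolynomial (τ ⊕ ι) k) :
    (MvPolynomial.aeval (coordPart
      (MvPolynomial.X : CoeffIndex τ ι d → MvPolynomial (CoeffIndex τ ι d) k)) g).map
      ((MvPolynomial.aeval w : MvPolynomial (CoeffIndex τ ι d) k →ₐ[k] A) :
        MvPolynomial (CoeffIndex τ ι d) k →+* A) =
      MvPolynomial.aeval (coordPart w) g := by
  have h := MvPolynomial.comp_aeval_apply (coordPart
      (MvPolynomial.X : CoeffIndex τ ι d → MvPolynomial (CoeffIndex τ ι d) k))
      (Polynomial.mapAlgHom (MvPolynomial.aeval w : MvPolynomial (CoeffIndex τ ι d) k →ₐ[k] A)) g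
  refine h.trans ?_
  congr 2
  funext j
  refine (map_coordPart _ _ j).trans ?_
  congr 1
  funext i
  simp

variable {τ ι : Type} [Fintype ι] [DecidableEq ι] (p : ι → MvPolynomial (τ ⊕ ι) k) (d : ℕ)

/-- The equations of the scheme parametrizing the data attached to arcs. -/
noncomputable def datumIdeal : Ideal (MvPolynomial (CoeffIndex τ ι d) k) :=
  let w : CoeffIndex τ ι d → MvPolynomial (CoeffIndex τ ι d) k := MvPolynomial.X
  Ideal.span ({c | ∃ n, c = (MvPolynomial.aeval (coordPart w) (jacobian p).det %ₘ
      monicPart w).coeff n} ∪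
    ({c | ∃ i n, c = (MvPolynomial.aeval (coordPart w) (p i) %ₘ monicPart w).coeff n} ∪
    {c | ∃ i n, c = (MvPolynomial.aeval (coordPart w) (adjugateMulVec p i) %ₘ
      monicPart w ^ 2).coeff n}))

variable {p d}

/-- Division by a monic polynomial commutes with base change, so the remainders for w are
specialisations of the remainders for the generic data. -/
theorem datumIdeal_le_ker_iff {A : Type*} [CommRing A] [Algebra k A]
    (w : CoeffIndex τ ι d → A) :
    datumIdeal p d ≤
      RingHom.ker (MvPolynomial.aeval w : MvPolynomial (CoeffIndex τ ι d) k →ₐ[k] A) ↔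
      IsDatum p d w := by
  let W : CoeffIndex τ ι d → MvPolynomial (CoeffIndex τ ι d) k := MvPolynomial.X
  have hm : (monicPart W).map ((MvPolynomial.aeval w : MvPolynomial (CoeffIndex τ ι d) k →ₐ[k] A) :
        MvPolynomial (CoeffIndex τ ι d) k →+* A) =
      monicPart w := by
    rw [map_monicPart]
    congr 1
    funext i
    simp [W]
  have key : ∀ (g : MvPolynomial (τ ⊕ ι) k) (n m : ℕ), MvPolynomial.aeval w
      ((MvPolynomial.aeval (coordPart W) g %ₘ monicPart W ^ n).coeff m) =
      (MvPolynomial.aeval (coordPart w) g %ₘ monicPart w ^ n).coeff m := by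
    intro g n m
    rw [← map_aeval_coordPart w g, ← hm, ← Polynomial.map_pow,
      ← Polynomial.map_modByMonic _ ((monicPart_monic W).pow n), Polynomial.coeff_map]
    rfl
  have key1 := fun g m => key g 1 m
  simp only [pow_one] at key1
  rw [datumIdeal, Ideal.span_le]
  constructor
  · intro h
    refine ⟨?_, fun i => ?_, fun i => ?_⟩
    · ext n
      rw [← key1]
      exact h (Or.inl ⟨n, rfl⟩)
    · ext n
      rw [← key1]
      exact h (Or.inr (Or.inl ⟨i, n, rfl⟩))
    · ext n
      rw [← key]
      exact h (Or.inr (Or.inr ⟨i, n, rfl⟩))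
  · rintro h c (⟨n, rfl⟩ | ⟨i, n, rfl⟩ | ⟨i, n, rfl⟩)
    · exact (key1 _ n).trans (by rw [h.det, Polynomial.coeff_zero])
    · exact (key1 _ n).trans (by rw [h.eqn, Polynomial.coeff_zero])
    · exact (key _ 2 n).trans (by rw [h.adj, Polynomial.coeff_zero])

variable (p d) in
/-- The coordinate ring of the scheme parametrizing the data attached to arcs. -/
noncomputable abbrev DatumRing : Type u := MvPolynomial (CoeffIndex τ ι d) k ⧸ datumIdeal p d

/-- The data given by a point of the parameter scheme. -/
noncomputable def datumOfHom {A : Type*} [CommRing A] [Algebra k A] (b : DatumRing p d →ₐ[k] A) :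
    CoeffIndex τ ι d → A :=
  fun i => b (Ideal.Quotient.mkₐ k (datumIdeal p d) (MvPolynomial.X i))

theorem isDatum_datumOfHom {A : Type*} [CommRing A] [Algebra k A] (b : DatumRing p d →ₐ[k] A) :
    IsDatum p d (datumOfHom b) := by
  rw [← datumIdeal_le_ker_iff]
  intro g hg
  have : (MvPolynomial.aeval (datumOfHom b)) = b.comp (Ideal.Quotient.mkₐ k (datumIdeal p d)) := by
    ext i
    simp [datumOfHom]
  rw [RingHom.mem_ker, this, AlgHom.comp_apply, Ideal.Quotient.mkₐ_eq_mk,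
    Ideal.Quotient.eq_zero_iff_mem.2 hg, map_zero]

theorem datumOfHom_injective {A : Type*} [CommRing A] [Algebra k A] :
    Function.Injective (datumOfHom : (DatumRing p d →ₐ[k] A) → _) := fun _ _ h =>
  Ideal.Quotient.algHom_ext _ (MvPolynomial.algHom_ext fun i => congrFun h i)

theorem exists_datumOfHom_eq {A : Type*} [CommRing A] [Algebra k A] {w : CoeffIndex τ ι d → A}
    (h : IsDatum p d w) : ∃ b : DatumRing p d →ₐ[k] A, datumOfHom b = w := by
  refine ⟨Ideal.Quotient.liftₐ _ (MvPolynomial.aeval w) (datumIdeal_le_ker_iff w |>.2 h), ?_⟩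
  funext i
  exact MvPolynomial.aeval_X w i

/-- The power series obtained from given ones by adding points of the formal disk to the
coefficients. -/
noncomputable def seriesOfDisk (e : τ × ℕ ≃ ℕ) (ξ₀ : τ → PowerSeries k) {A : TestRing k}
    (δ : (diskPow k).obj A) (t : τ) : PowerSeries A.obj :=
  PowerSeries.mk fun n => algebraMap k A.obj (PowerSeries.coeff n (ξ₀ t)) +
    (δ (e (t, n))).1 PowerSeries.X

theorem mapReduction_seriesOfDisk (e : τ × ℕ ≃ ℕ) (ξ₀ : τ → PowerSeries k) {A : TestRing k}
    (δ : (diskPow k).obj A) (t : τ) :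
    A.property.mapReduction (seriesOfDisk e ξ₀ δ t) = ξ₀ t := by
  ext n
  simp [IsTestRing.mapReduction, PowerSeries.mapAlgHom_apply, seriesOfDisk,
    A.property.disk_apply_X_mem _ (δ (e (t, n))).2]

/-- Each coefficient of ξ differs from that of ξ₀ by an element of m, that is, by a point of the
disk; `e` enumerates all these coefficients. -/
theorem existsUnique_seriesOfDisk (e : τ × ℕ ≃ ℕ) {ξ₀ : τ → PowerSeries k} {A : TestRing k}
    {ξ : τ → PowerSeries A.obj} (hξ : ∀ t, A.property.mapReduction (ξ t) = ξ₀ t) :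
    ∃! δ : (diskPow k).obj A, seriesOfDisk e ξ₀ δ = ξ := by
  have h : ∀ m : ℕ, A.property.reduction (PowerSeries.coeff (e.symm m).2 (ξ (e.symm m).1) -
      algebraMap k A.obj (PowerSeries.coeff (e.symm m).2 (ξ₀ (e.symm m).1))) = 0 := by
    intro m
    rw [← hξ]
    simp [IsTestRing.mapReduction, PowerSeries.mapAlgHom_apply]
  choose δ hδ hδ' using fun m => A.property.existsUnique_disk (h m)
  refine ⟨δ, ?_, fun δ' h' => ?_⟩
  · funext t
    ext n
    simp only [seriesOfDisk, PowerSeries.coeff_mk, hδ]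
    simp
  · funext m
    refine hδ' m _ ?_
    simp only [← h', seriesOfDisk, PowerSeries.coeff_mk]
    simp

theorem seriesOfDisk_map (e : τ × ℕ ≃ ℕ) (ξ₀ : τ → PowerSeries k) {A B : TestRing k} (f : A ⟶ B)
    (δ : (diskPow k).obj A) (t : τ) :
    PowerSeries.mapAlgHom f.hom.hom (seriesOfDisk e ξ₀ δ t) =
      seriesOfDisk e ξ₀ ((diskPow k).map f δ) t := by
  ext n
  simp only [PowerSeries.mapAlgHom_apply, seriesOfDisk, PowerSeries.coeff_map, PowerSeries.coeff_mk,
    map_add]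
  congr 1
  exact f.hom.hom.commutes _

end Functors

/-! ### From the bijection on points to the isomorphism of functors -/

section AffineCase

variable {k : Type u} [Field k] {τ ι : Type}
  {p : ι → MvPolynomial (τ ⊕ ι) k} {B : Type u} [CommRing B] [Algebra k B]
  {φ₀ : B →ₐ[k] PowerSeries k} {π : MvPolynomial (τ ⊕ ι) k →ₐ[k] B}

/-- Near an arc on which `h` does not vanish, the arcs in a closed subscheme of affine space are
those of a larger closed subscheme which agrees with it where `h` is invertible. -/
theorem exists_comp_X_eq (hπ : Function.Surjective π) {h : MvPolynomial (τ ⊕ ι) k}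
    (hh : φ₀ (π h) ≠ 0) (hker : ∀ g, π g = 0 → h * g ∈ Ideal.span (Set.range p))
    {A : Type u} [CommRing A] [Algebra k A] (hA : IsTestRing k A) {z : τ ⊕ ι → PowerSeries A}
    (hz : ∀ j, hA.mapReduction (z j) = φ₀ (π (MvPolynomial.X j)))
    (hpz : ∀ i, MvPolynomial.aeval z (p i) = 0) :
    ∃ φ : B →ₐ[k] PowerSeries A, hA.mapReduction.comp φ = φ₀ ∧
      ∀ j, φ (π (MvPolynomial.X j)) = z j := by
  have hred : hA.mapReduction.comp (MvPolynomial.aeval z) = φ₀.comp π := by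
    ext1 j
    simp [hz]
  have hle : RingHom.ker (π : MvPolynomial (τ ⊕ ι) k →+* B) ≤
      RingHom.ker (MvPolynomial.aeval z : MvPolynomial (τ ⊕ ι) k →ₐ[k] PowerSeries A) := by
    intro g hg
    have h1 : Ideal.span (Set.range p) ≤
        RingHom.ker (MvPolynomial.aeval z : MvPolynomial (τ ⊕ ι) k →ₐ[k] PowerSeries A) := by
      rw [Ideal.span_le]
      rintro _ ⟨i, rfl⟩
      exact hpz i
    -- The value of h at z reduces to φ₀ (π h) ≠ 0, so it is not a zero divisor and can be
    -- cancelled.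
    have h2 : MvPolynomial.aeval z (h * g) = 0 := h1 (hker g hg)
    rw [map_mul] at h2
    refine hA.eq_zero_of_mul_eq_zero ?_ h2
    have h3 := DFunLike.congr_fun hred h
    rw [AlgHom.comp_apply, AlgHom.comp_apply] at h3
    rwa [h3]
  have hlift : ∀ g, AlgHom.liftOfSurjective π hπ (MvPolynomial.aeval z) hle (π g) =
      MvPolynomial.aeval z g := AlgHom.liftOfSurjective_apply π hπ _ hle
  refine ⟨AlgHom.liftOfSurjective π hπ (MvPolynomial.aeval z) hle, ?_, fun j => ?_⟩
  · ext1 b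
    obtain ⟨g, rfl⟩ := hπ b
    rw [AlgHom.comp_apply, hlift]
    exact DFunLike.congr_fun hred g
  · rw [hlift, MvPolynomial.aeval_X]

variable [Fintype τ] [Fintype ι] [DecidableEq ι]

/-- The theorem for closed subschemes of affine space which are complete intersections along the
generic point of the arc. -/
theorem exists_formalNbhd_arcs_iso [Nonempty τ] (hπ : Function.Surjective π)
    (hp : ∀ i, π (p i) = 0) {h : MvPolynomial (τ ⊕ ι) k}
    (hh : φ₀ (π h) ≠ 0) (hker : ∀ g, π g = 0 → h * g ∈ Ideal.span (Set.range p))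
    (hdet : φ₀ (π (jacobian p).det) ≠ 0) :
    ∃ (R : Type u) (_ : CommRing R) (_ : Algebra k R) (_ : Algebra.FiniteType k R)
      (ρ₀ : R →ₐ[k] k), Nonempty
        (formalNbhd (powerSeries k ⋙ homs B) (CommAlgCat.ofHom φ₀) ≅
          FunctorToTypes.prod (diskPow k) (formalNbhd (homs R) (CommAlgCat.ofHom ρ₀))) := by
  have hk := isTestRing_self (k := k)
  have hkred : hk.reduction = AlgHom.id k k := hk.algHom_ext _ _
  have hkmap : ∀ f, hk.mapReduction f = f := by
    intro f
    ext n
    simp [IsTestRing.mapReduction, hkred, PowerSeries.mapAlgHom_apply]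
  have hev : ∀ {A : Type u} [CommRing A] [Algebra k A] (φ : B →ₐ[k] PowerSeries A) g,
      MvPolynomial.aeval (fun j => φ (π (MvPolynomial.X j))) g = φ (π g) := by
    intro A _ _ φ g
    have : MvPolynomial.aeval (fun j => φ (π (MvPolynomial.X j))) = φ.comp π := by
      ext1 j
      simp
    rw [this, AlgHom.comp_apply]
  have hevp : ∀ {A : Type u} [CommRing A] [Algebra k A] (φ : B →ₐ[k] PowerSeries A) i,
      MvPolynomial.aeval (fun j => φ (π (MvPolynomial.X j))) (p i) = 0 := fun φ i => by
    rw [hev, hp, map_zero]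
  let z₀ : τ ⊕ ι → PowerSeries k := fun j => φ₀ (π (MvPolynomial.X j))
  have hz₀ : ∀ i, MvPolynomial.aeval z₀ (p i) = 0 := hevp φ₀
  have hv := PowerSeries.isUnit_divided_by_X_pow_order hdet
  have hdet' := (PowerSeries.X_pow_order_mul_divXPowOrder (f := φ₀ (π (jacobian p).det))).symm
  set v := PowerSeries.divXPowOrder (φ₀ (π (jacobian p).det))
  set d := (φ₀ (π (jacobian p).det)).order.toNat
  rw [← hev] at hdet'
  -- The base point of Y and the reference series come from γ₀ itself, regarded as an arc over the
  -- test-ring k.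
  obtain ⟨⟨ξ₀, w₀⟩, ⟨hw₀, hd₀⟩, huniq⟩ := existsUnique_datum hk hv ((hkmap _).trans hdet')
  have hm₀ : monicPart w₀ = Polynomial.X ^ d := by
    have := hw₀.map_eq
    rw [hkred] at this
    simpa using this
  obtain ⟨ρ₀, hρ₀⟩ : ∃ ρ₀ : DatumRing p d →ₐ[k] k, datumOfHom ρ₀ = w₀ :=
    exists_datumOfHom_eq (hd₀.isDatum hk hw₀ hz₀)
  -- Nonemptiness of `τ` enters here: without it there would be no disks at all.
  obtain ⟨e⟩ : Nonempty (τ × ℕ ≃ ℕ) := by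
    have := Encodable.ofCountable τ
    have := Denumerable.ofEncodableOfInfinite (τ × ℕ)
    exact ⟨Denumerable.eqv _⟩
  have hbred : ∀ (A : TestRing k)
      (b : (formalNbhd (homs (DatumRing p d)) (CommAlgCat.ofHom ρ₀)).obj A) (i : CoeffIndex τ ι d),
      A.property.reduction (datumOfHom b.1.hom i) = w₀ i := by
    intro A b i
    refine Eq.trans ?_ (congrFun hρ₀ i)
    exact congrArg (fun c => datumOfHom (CommAlgCat.Hom.hom c) i) b.2
  refine ⟨DatumRing p d, inferInstance, inferInstance, inferInstance, ρ₀,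
    nonempty_iso_of_relation (fun A a b => IsDatumOf p d
      (fun j => a.1.hom (π (MvPolynomial.X j))) (seriesOfDisk e ξ₀ b.1)
      (datumOfHom b.2.1.hom)) ?_ ?_ ?_⟩
  · intro A A' f a b hab
    have := hab.map f.hom.hom
    simp only [seriesOfDisk_map] at this
    exact this
  · intro A a
    let φ : B →ₐ[k] PowerSeries A.obj := a.1.hom
    have hφ : A.property.mapReduction.comp φ = φ₀ := congrArg CommAlgCat.Hom.hom a.2
    have hφ' : ∀ b, A.property.mapReduction (φ b) = φ₀ b := DFunLike.congr_fun hφ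
    obtain ⟨⟨ξ, w⟩, ⟨hw, hdat⟩, hu⟩ := existsUnique_datum (p := p) (d := d) (v := v)
      (z := fun j => φ (π (MvPolynomial.X j))) A.property hv (by rw [hev, hφ', ← hev, hdet'])
    -- The reductions of ξ and w are data of γ₀, hence equal to ξ₀ and w₀ by uniqueness.
    have hred := huniq ((fun t => A.property.mapReduction (ξ t)),
        fun i => A.property.reduction (w i)) (by
      refine ⟨?_, ?_⟩
      · refine IsTestRing.IsDistinguished.monicPart hk ?_
        rw [← hw.map_eq, map_monicPart, hkred]
        rfl
      · have := hdat.map A.property.reduction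
        simp only [← IsTestRing.mapReduction.eq_def, hφ'] at this
        exact this)
    obtain ⟨b, hb⟩ : ∃ b : DatumRing p d →ₐ[k] A.obj, datumOfHom b = w :=
      exists_datumOfHom_eq (hdat.isDatum A.property hw (hevp φ))
    obtain ⟨δ, hδ, hδ'⟩ := existsUnique_seriesOfDisk e (ξ := ξ) (ξ₀ := ξ₀)
      (fun t => congrFun (congrArg Prod.fst hred) t)
    refine ⟨⟨δ, ⟨CommAlgCat.ofHom b, ?_⟩⟩, ?_, ?_⟩
    · refine CommAlgCat.hom_ext (datumOfHom_injective ?_)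
      refine Eq.trans ?_ hρ₀.symm
      refine Eq.trans ?_ (congrArg Prod.snd hred)
      exact funext fun i => congrArg A.property.reduction (congrFun hb i)
    · have := hdat
      rw [← hb, ← hδ] at this
      exact this
    · rintro ⟨δ', b'⟩ h'
      have hdist : A.property.IsDistinguished d (monicPart (datumOfHom b'.1.hom)) :=
        IsTestRing.IsDistinguished.monicPart A.property
          ((congrArg monicPart (funext (hbred A b'))).trans hm₀)
      have h1 := hu (_, _) ⟨hdist, h'⟩
      refine Prod.ext (hδ' _ (congrArg Prod.fst h1)) (Subtype.ext (CommAlgCat.hom_ext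
        (datumOfHom_injective ?_)))
      exact (congrArg Prod.snd h1).trans hb.symm
  · rintro A ⟨δ, b⟩
    obtain ⟨z, ⟨hz, hpz, hd⟩, hu⟩ := existsUnique_arc A.property hz₀ hv hdet' hm₀ hd₀
      (mapReduction_seriesOfDisk e ξ₀ δ) (hbred A b) (isDatum_datumOfHom b.1.hom)
    obtain ⟨φ, hφ, hφz⟩ := exists_comp_X_eq hπ hh hker A.property hz hpz
    refine ⟨⟨CommAlgCat.ofHom φ, CommAlgCat.hom_ext hφ⟩, ?_, ?_⟩
    · obtain rfl : (fun j => φ (π (MvPolynomial.X j))) = z := funext hφz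
      exact hd
    · intro a' h'
      have hφ' : A.property.mapReduction.comp a'.1.hom = φ₀ := congrArg CommAlgCat.Hom.hom a'.2
      have h1 := hu (fun j => a'.1.hom (π (MvPolynomial.X j)))
        ⟨fun j => DFunLike.congr_fun hφ' _, hevp (A := A.obj) a'.1.hom, h'⟩
      refine Subtype.ext (CommAlgCat.hom_ext ?_)
      have h2 : (a'.1.hom : B →ₐ[k] PowerSeries A.obj).comp π = φ.comp π := by
        ext1 j
        exact (congrFun h1 j).trans (hφz j).symm
      ext1 c
      obtain ⟨g, rfl⟩ := hπ c
      exact DFunLike.congr_fun h2 g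

end AffineCase

/-! ### Smooth points of closed subschemes of affine space -/

section JacobianCriterion

/-- If `S → C` is surjective with kernel `J` and `C` is formally smooth over `k`, then modulo
`J ^ 2` the elements of `J` are determined by their differentials. -/
theorem exists_sub_sum_pderiv_mem_sq {k σ S C : Type*} [CommRing k] [Fintype σ] [CommRing S]
    [Algebra k S] [CommRing C] [Algebra k C] [Algebra.FormallySmooth k C] (g : S →ₐ[k] C)
    (hg : Function.Surjective g) (z : σ → S) :
    ∃ c : σ → S, (∀ j, c j ∈ RingHom.ker g) ∧ ∀ f : MvPolynomial σ k,
      MvPolynomial.aeval z f ∈ RingHom.ker g → MvPolynomial.aeval z f -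
        ∑ j, MvPolynomial.aeval z (MvPolynomial.pderiv j f) * c j ∈ RingHom.ker g ^ 2 := by
  let J := RingHom.ker g
  let g' : S ⧸ J ^ 2 →ₐ[k] C := Ideal.Quotient.liftₐ (J ^ 2) g fun a ha =>
    Ideal.pow_le_self two_ne_zero ha
  have hg'mk : ∀ a, g' (Ideal.Quotient.mkₐ k (J ^ 2) a) = g a := fun a => rfl
  have hg' : Function.Surjective g' := fun c => by
    obtain ⟨a, rfl⟩ := hg c
    exact ⟨_, hg'mk a⟩
  have hker : RingHom.ker (g' : S ⧸ J ^ 2 →+* C) = J.map (Ideal.Quotient.mk (J ^ 2)) := by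
    ext a
    obtain ⟨a, rfl⟩ := Ideal.Quotient.mk_surjective a
    rw [Ideal.mem_quotient_iff_mem (Ideal.pow_le_self two_ne_zero)]
    rfl
  have hnil : IsNilpotent (RingHom.ker (g' : S ⧸ J ^ 2 →+* C)) := by
    refine ⟨2, ?_⟩
    rw [hker, ← Ideal.map_pow, Ideal.map_quotient_self]
    rfl
  -- Formal smoothness splits S / J² → C. The coefficients c measure how far each z j is from a lift
  -- y j of its image under the splitting.
  let s : C →ₐ[k] S ⧸ J ^ 2 := Algebra.FormallySmooth.liftOfSurjective (AlgHom.id k C) g' hg' hnil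
  have hs : ∀ c, g' (s c) = c :=
    Algebra.FormallySmooth.liftOfSurjective_apply (AlgHom.id k C) g' hg' hnil
  choose y hy using fun j => Ideal.Quotient.mkₐ_surjective k (J ^ 2) (s (g (z j)))
  refine ⟨fun j => z j - y j, fun j => ?_, fun f hf => ?_⟩
  · rw [RingHom.mem_ker, map_sub, ← hg'mk (y j), hy, hs, sub_self]
  · obtain ⟨R, hR, h⟩ := aeval_add_mul_sub_aeval_add_mul f z (fun j => y j - z j) 0 1 J J
      (fun j => by
        rw [RingHom.mem_ker, map_sub, ← hg'mk (y j), hy, hs, sub_self]) (by simp)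
      (fun j => by
        rw [Pi.zero_apply, sub_zero, RingHom.mem_ker, map_sub, ← hg'mk (y j), hy, hs, sub_self])
    simp only [one_mul, add_sub_cancel, Pi.zero_apply, add_zero, sub_zero, one_pow] at h
    -- Modulo J², f(y) is the image under the section s of g (f(z)) = 0; Taylor expansion between z
    -- and y then gives the claim.
    have h0 : MvPolynomial.aeval y f ∈ J ^ 2 := by
      rw [← Ideal.Quotient.eq_zero_iff_mem, ← Ideal.Quotient.mkₐ_eq_mk k,
        MvPolynomial.comp_aeval_apply]
      simp only [hy]
      have := MvPolynomial.comp_aeval_apply z (s.comp g) f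
      simp only [AlgHom.comp_apply] at this
      rw [← this, RingHom.mem_ker.1 hf, map_zero]
    have h1 : MvPolynomial.aeval z f - ∑ j, MvPolynomial.aeval z (MvPolynomial.pderiv j f) *
        (z j - y j) = MvPolynomial.aeval y f - R := by
      have : ∑ j, MvPolynomial.aeval z (MvPolynomial.pderiv j f) * (z j - y j) =
          -∑ j, MvPolynomial.aeval z (MvPolynomial.pderiv j f) * (y j - z j) := by
        rw [← Finset.sum_neg_distrib]
        exact Finset.sum_congr rfl fun j _ => by ring
      rw [this]
      linear_combination -h
    rw [h1]
    exact sub_mem h0 (sq J ▸ hR)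

/-- A matrix with linearly independent rows has a nonzero maximal minor. -/
theorem exists_det_submatrix_ne_zero {K ι σ : Type*} [Field K] [Fintype ι] [DecidableEq ι]
    [Finite σ] (M : Matrix ι σ K) (hM : LinearIndependent K M.row) :
    ∃ e : ι → σ, Function.Injective e ∧ (M.submatrix id e).det ≠ 0 := by
  have := Fintype.ofFinite σ
  obtain ⟨κ, a, ha, hspan, hind⟩ := exists_linearIndependent' K M.col
  have : Finite κ := Finite.of_injective a ha
  have := Fintype.ofFinite κ
  -- Row rank equals column rank.
  have hcard : Fintype.card ι = Fintype.card κ := by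
    rw [← hM.rank_matrix, M.rank_eq_finrank_span_cols, ← hspan, finrank_span_eq_card hind]
  let e := Fintype.equivOfCardEq hcard
  refine ⟨a ∘ e, ha.comp e.injective, ?_⟩
  have h1 : LinearIndependent K (M.submatrix id (a ∘ e)).transpose.row := hind.comp e e.injective
  rw [Matrix.linearIndependent_rows_iff_isUnit, Matrix.isUnit_iff_isUnit_det,
    Matrix.det_transpose] at h1
  exact h1.ne_zero

theorem sum_sub_sum_mul_mul {S ι σ : Type*} [CommRing S] [Fintype ι] [Fintype σ] (x c : σ → S)
    (b : ι → S) (m : ι → σ → S) :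
    ∑ j, (x j - ∑ i, b i * m i j) * c j = ∑ j, x j * c j - ∑ i, b i * ∑ j, m i j * c j := by
  simp only [sub_mul, Finset.sum_sub_distrib, Finset.sum_mul, Finset.mul_sum, mul_assoc]
  rw [Finset.sum_comm]

/-- Near a smooth point, a closed subscheme of affine space is a complete intersection, with
equations whose Jacobian matrix has a nonzero maximal minor at the given point. -/
theorem exists_equations_of_formallySmooth {k σ B : Type*} [Field k] [Finite σ] [CommRing B]
    [Algebra k B] {π : MvPolynomial σ k →ₐ[k] B} (hπ : Function.Surjective π) (P : Ideal B)
    [P.IsPrime] [Algebra.FormallySmooth k (Localization.AtPrime P)] :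
    ∃ (r : ℕ) (f : Fin r → MvPolynomial σ k) (e : Fin r → σ) (h : MvPolynomial σ k),
      Function.Injective e ∧ (∀ i, π (f i) = 0) ∧ π h ∉ P ∧
      (∀ g, π g = 0 → h * g ∈ Ideal.span (Set.range f)) ∧
      π (Matrix.of fun i j => MvPolynomial.pderiv (e j) (f i)).det ∉ P := by
  have := Fintype.ofFinite σ
  let Q : Ideal (MvPolynomial σ k) := P.comap π
  have hQ : Q.IsPrime := Ideal.comap_isPrime π P
  let S := Localization.AtPrime Q
  let K := IsLocalRing.ResidueField S
  let ev : MvPolynomial σ k →ₐ[k] S := IsScalarTower.toAlgHom k (MvPolynomial σ k) S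
  let res : S →+* K := IsLocalRing.residue S
  let z : σ → S := fun j => ev (MvPolynomial.X j)
  have hz : ∀ f, MvPolynomial.aeval z f = ev f := fun f => by
    have : MvPolynomial.aeval z = ev := by
      ext1 j
      simp [z]
    rw [this]
  -- the surjection of local rings and its kernel
  let g₀ : S →+* Localization.AtPrime P := Localization.localRingHom Q P π rfl
  have hg₀ : ∀ f, g₀ (ev f) = algebraMap B _ (π f) := Localization.localRingHom_to_map Q P π rfl
  let g : S →ₐ[k] Localization.AtPrime P :=
    { g₀ with
      commutes' := fun c => by
        have h1 : algebraMap k S c = ev (algebraMap k _ c) := (ev.commutes c).symm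
        change g₀ _ = _
        rw [h1, hg₀, AlgHom.commutes, ← IsScalarTower.algebraMap_apply] }
  have hgev : ∀ f, g (ev f) = algebraMap B _ (π f) := hg₀
  have hT : Submonoid.map (π : MvPolynomial σ k →+* B) Q.primeCompl = P.primeCompl := by
    ext b
    constructor
    · rintro ⟨f, hf, rfl⟩
      exact hf
    · intro hb
      obtain ⟨f, rfl⟩ := hπ b
      exact ⟨f, hb, rfl⟩
  have hker : RingHom.ker g = (RingHom.ker (π : MvPolynomial σ k →+* B)).map ev :=
    IsLocalization.ker_map (S := S) (Localization.AtPrime P) (π : MvPolynomial σ k →+* B) hT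
  have hg : Function.Surjective g := by
    intro x
    obtain ⟨b, s, rfl⟩ := IsLocalization.exists_mk'_eq P.primeCompl x
    obtain ⟨b, rfl⟩ := hπ b
    obtain ⟨s, hs⟩ := s
    obtain ⟨s, rfl⟩ := hπ s
    refine ⟨IsLocalization.mk' S b (⟨s, hs⟩ : Q.primeCompl), ?_⟩
    rw [IsLocalization.eq_mk'_iff_mul_eq]
    change g _ * algebraMap B _ (π s) = algebraMap B _ (π b)
    rw [← hgev, ← map_mul, ← hgev]
    congr 1
    exact IsLocalization.mk'_spec S b (⟨s, hs⟩ : Q.primeCompl)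
  obtain ⟨c, hc, hcf⟩ := exists_sub_sum_pderiv_mem_sq g hg z
  -- the equations
  let grad : RingHom.ker (π : MvPolynomial σ k →+* B) → σ → K := fun f j =>
    res (ev (MvPolynomial.pderiv j f.1))
  -- The equations are elements of the ideal whose gradients form a basis of the span of all
  -- gradients over the residue field.
  obtain ⟨κ, a, -, hspan, hind⟩ := exists_linearIndependent' K grad
  have : Finite κ := hind.finite
  obtain ⟨r, ⟨eκ⟩⟩ := Finite.exists_equiv_fin κ
  let f : Fin r → MvPolynomial σ k := fun i => (a (eκ.symm i)).1
  have hf : ∀ i, π (f i) = 0 := fun i => (a (eκ.symm i)).2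
  have hind' : LinearIndependent K fun i : Fin r => grad (a (eκ.symm i)) :=
    hind.comp eκ.symm eκ.symm.injective
  have hspan' : ∀ x, grad x ∈
      Submodule.span K (Set.range fun i : Fin r => grad (a (eκ.symm i))) := by
    intro x
    have h1 : (Set.range fun i : Fin r => grad (a (eκ.symm i))) = Set.range (grad ∘ a) :=
      eκ.symm.surjective.range_comp (grad ∘ a)
    rw [h1, hspan]
    exact Submodule.subset_span ⟨x, rfl⟩
  obtain ⟨e, he, hdet⟩ := exists_det_submatrix_ne_zero
    (Matrix.of fun i : Fin r => grad (a (eκ.symm i))) hind'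
  -- Nakayama: modulo the maximal ideal times the kernel, an equation is determined by its gradient
  -- at the point, which is a combination of the gradients of the f i.
  have hJ : RingHom.ker g ≤ Ideal.span (Set.range fun i => ev (f i)) := by
    refine Submodule.le_of_le_smul_of_le_jacobson_bot
      (I := IsLocalRing.maximalIdeal S) ?_ (IsLocalRing.jacobson_eq_maximalIdeal _ bot_ne_top).ge ?_
    · rw [hker]
      exact ((isNoetherianRing_iff_ideal_fg _).1 inferInstance _).map _
    · rw [hker, Ideal.map_le_iff_le_comap, ← hker]
      intro x hx
      obtain ⟨b, hb⟩ := (Submodule.mem_span_range_iff_exists_fun K).1 (hspan' ⟨x, hx⟩)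
      choose b' hb' using fun i => IsLocalRing.residue_surjective (b i)
      have hmem : ∀ y, π y = 0 → ev y - ∑ j, ev (MvPolynomial.pderiv j y) * c j ∈
          IsLocalRing.maximalIdeal S • RingHom.ker g := by
        intro y hy
        have h1 := hcf y (by rw [hz, RingHom.mem_ker, hgev, hy, map_zero])
        simp only [hz, sq] at h1
        exact Ideal.mul_mono_left (IsLocalRing.le_maximalIdeal (RingHom.ker_ne_top _)) h1
      have hcoef : ∀ j, ev (MvPolynomial.pderiv j x) -
          ∑ i, b' i * ev (MvPolynomial.pderiv j (f i)) ∈ IsLocalRing.maximalIdeal S := by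
        intro j
        have h1 := congrFun hb j
        rw [← IsLocalRing.residue_eq_zero_iff, map_sub, sub_eq_zero, map_sum]
        simp only [map_mul, hb']
        rw [Finset.sum_apply] at h1
        exact h1.symm
      have hsum : ∑ j, (ev (MvPolynomial.pderiv j x) -
          ∑ i, b' i * ev (MvPolynomial.pderiv j (f i))) * c j =
          ∑ j, ev (MvPolynomial.pderiv j x) * c j -
          ∑ i, b' i * ∑ j, ev (MvPolynomial.pderiv j (f i)) * c j :=
        sum_sub_sum_mul_mul _ _ _ _
      have key : ev x = ∑ i, b' i * ev (f i) +
          ((ev x - ∑ j, ev (MvPolynomial.pderiv j x) * c j) -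
          ∑ i, b' i * (ev (f i) - ∑ j, ev (MvPolynomial.pderiv j (f i)) * c j) +
          ∑ j, (ev (MvPolynomial.pderiv j x) -
          ∑ i, b' i * ev (MvPolynomial.pderiv j (f i))) * c j) := by
        rw [hsum]
        simp only [mul_sub, Finset.sum_sub_distrib]
        ring
      rw [Ideal.mem_comap, key]
      refine Submodule.add_mem_sup (Ideal.sum_mem _ fun i _ => Ideal.mul_mem_left _ _
        (Ideal.subset_span ⟨i, rfl⟩)) (add_mem (sub_mem (hmem x hx) ?_) ?_)
      · exact Ideal.sum_mem _ fun i _ => Ideal.mul_mem_left _ _ (hmem _ (hf i))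
      · exact Ideal.sum_mem _ fun j _ => Ideal.mul_mem_mul (hcoef j) (hc j)
  have hex : ∀ x : MvPolynomial σ k, π x = 0 →
      ∃ s, π s ∉ P ∧ s * x ∈ Ideal.span (Set.range f) := by
    intro x hx
    have h1 : ev x ∈ (Ideal.span (Set.range f)).map (algebraMap (MvPolynomial σ k) S) := by
      rw [Ideal.map_span, ← Set.range_comp]
      refine hJ ?_
      rw [RingHom.mem_ker, hgev, hx, map_zero]
    obtain ⟨⟨y, s⟩, hy⟩ := (IsLocalization.mem_map_algebraMap_iff Q.primeCompl S).1 h1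
    refine ⟨s, s.2, ?_⟩
    have h2 : algebraMap (MvPolynomial σ k) S (s * x) = algebraMap (MvPolynomial σ k) S y := by
      rw [map_mul, mul_comm]
      exact hy
    -- The polynomial ring is a domain, so the relation already holds before localization.
    rw [IsLocalization.injective S Q.primeCompl_le_nonZeroDivisors h2]
    exact y.2
  obtain ⟨T, hT⟩ := (isNoetherianRing_iff_ideal_fg (MvPolynomial σ k)).1 inferInstance
    (RingHom.ker (π : MvPolynomial σ k →+* B))
  choose! s hsP hs using hex
  have hTker : ∀ x ∈ T, π x = 0 := fun x hx =>
    RingHom.mem_ker.1 (hT ▸ Submodule.subset_span hx : x ∈ RingHom.ker (π : MvPolynomial σ k →+* B))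
  -- A common denominator for a finite set of generators of the kernel.
  refine ⟨r, f, e, ∏ x ∈ T, s x, he, hf, ?_, ?_, ?_⟩
  · rw [map_prod]
    exact fun h => by
      obtain ⟨x, hx, hxP⟩ := (Ideal.IsPrime.prod_mem_iff).1 h
      exact hsP x (hTker x hx) hxP
  · have hle : Ideal.span (T : Set (MvPolynomial σ k)) ≤
        Submodule.comap (LinearMap.mulLeft (MvPolynomial σ k) (∏ x ∈ T, s x))
          (Ideal.span (Set.range f)) := by
      rw [Ideal.span, Submodule.span_le]
      intro x hxT
      classical
      change (∏ x ∈ T, s x) * x ∈ Ideal.span (Set.range f)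
      rw [← Finset.prod_erase_mul _ _ hxT, mul_assoc]
      exact Ideal.mul_mem_left _ _ (hs x (hTker x hxT))
    exact fun x hx => hle (hT ▸ hx)
  · intro hP
    refine hdet ?_
    have h1 : res (ev (Matrix.of fun i j => MvPolynomial.pderiv (e j) (f i)).det) = 0 := by
      rw [IsLocalRing.residue_eq_zero_iff]
      exact (IsLocalization.AtPrime.to_map_mem_maximal_iff S Q _).2 hP
    rw [AlgHom.map_det, RingHom.map_det] at h1
    exact h1

end JacobianCriterion

/-! ### Splitting the coordinates, and the case with no free coordinate -/

section Presentation

/-- Near a smooth point, a closed subscheme of affine space is defined by equations indexed by a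
subset of the coordinates, with invertible partial Jacobian. -/
theorem exists_presentation_of_formallySmooth {k B : Type*} [Field k] [CommRing B]
    [Algebra k B] [Algebra.FiniteType k B] (P : Ideal B)
    [P.IsPrime] [Algebra.FormallySmooth k (Localization.AtPrime P)] :
    ∃ (τ ι : Type) (_ : Fintype τ) (_ : Fintype ι) (_ : DecidableEq ι)
      (p : ι → MvPolynomial (τ ⊕ ι) k) (π : MvPolynomial (τ ⊕ ι) k →ₐ[k] B)
      (h : MvPolynomial (τ ⊕ ι) k), Function.Surjective π ∧ (∀ i, π (p i) = 0) ∧ π h ∉ P ∧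
      (∀ g, π g = 0 → h * g ∈ Ideal.span (Set.range p)) ∧ π (jacobian p).det ∉ P := by
  obtain ⟨n, π, hπ⟩ := Algebra.FiniteType.iff_quotient_mvPolynomial''.1 ‹Algebra.FiniteType k B›
  obtain ⟨r, f, e, h, he, hf, hh, hker, hdet⟩ := exists_equations_of_formallySmooth hπ P
  -- The coordinates of the nonzero minor become `ι`, the remaining ones `τ`.
  let E : {j // j ∉ Set.range e} ⊕ Fin r ≃ Fin n := by
    refine Equiv.ofBijective (Sum.elim Subtype.val e) ⟨?_, fun j => ?_⟩
    · exact Subtype.val_injective.sumElim he fun a b hab => a.2 ⟨b, hab.symm⟩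
    · by_cases hj : j ∈ Set.range e
      · obtain ⟨i, rfl⟩ := hj
        exact ⟨Sum.inr i, rfl⟩
      · exact ⟨Sum.inl ⟨j, hj⟩, rfl⟩
  let R := MvPolynomial.renameEquiv k E
  have hRX : ∀ i, E (Sum.inr i) = e i := fun i => rfl
  refine ⟨{j // j ∉ Set.range e}, Fin r, Fintype.ofFinite _, inferInstance, inferInstance,
    fun i => R.symm (f i), π.comp R, R.symm h, hπ.comp R.surjective, fun i => ?_, ?_,
    fun g hg => ?_, ?_⟩
  · simp [hf]
  · simpa using hh
  · have h1 := Ideal.mem_map_of_mem R.symm (hker (R g) hg)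
    rw [Ideal.map_span, ← Set.range_comp, map_mul, AlgEquiv.symm_apply_apply] at h1
    exact h1
  · have hjac : (R : _ →ₐ[k] MvPolynomial (Fin n) k).mapMatrix
        (jacobian fun i => R.symm (f i)) =
        Matrix.of fun i j => MvPolynomial.pderiv (e j) (f i) := by
      ext1 i j
      change MvPolynomial.rename E (MvPolynomial.pderiv (Sum.inr j) (R.symm (f i))) = _
      rw [← MvPolynomial.pderiv_rename E.injective, hRX]
      exact congrArg (MvPolynomial.pderiv (e j)) (R.apply_symm_apply (f i))
    rw [AlgHom.comp_apply, AlgHom.map_det, hjac]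
    exact hdet

/-- A point with invertible Jacobian determinant on a scheme defined by as many equations as
there are coordinates is isolated. -/
theorem isOpen_singleton_of_isEmpty {k : Type*} {B : Type*} [Field k] [CommRing B]
    [Algebra k B] [Algebra.FiniteType k B] {τ ι : Type} [IsEmpty τ] [Fintype ι] [DecidableEq ι]
    {p : ι → MvPolynomial (τ ⊕ ι) k} {π : MvPolynomial (τ ⊕ ι) k →ₐ[k] B}
    (hπ : Function.Surjective π) (hp : ∀ i, π (p i) = 0) (x : PrimeSpectrum B)
    (hdet : π (jacobian p).det ∉ x.asIdeal) : IsOpen {x} := by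
  let b := π (jacobian p).det
  let C := Localization.Away b
  have : Fintype τ := Fintype.ofIsEmpty
  have hfin : Algebra.FiniteType B C := IsLocalization.finiteType_of_monoid_fg (.powers b) C
  have hfin' : Algebra.FiniteType k C := Algebra.FiniteType.trans (S := B) inferInstance hfin
  -- Two lifts modulo a square-zero ideal differ by a vector u killed by the Jacobian matrix, which
  -- is invertible once its determinant is inverted.
  have hunr : Algebra.FormallyUnramified k C := by
    rw [Algebra.FormallyUnramified.iff_comp_injective]
    intro D _ _ I hI f g hfg
    let ι₀ : B →ₐ[k] C := IsScalarTower.toAlgHom k B C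
    suffices hX : ∀ j, f (ι₀ (π (MvPolynomial.X j))) = g (ι₀ (π (MvPolynomial.X j))) by
      have h1 : (f.comp ι₀).comp π = (g.comp ι₀).comp π := by
        ext1 j
        exact hX j
      have h2 : f.comp ι₀ = g.comp ι₀ := by
        ext1 c
        obtain ⟨q, rfl⟩ := hπ c
        exact DFunLike.congr_fun h1 q
      exact IsLocalization.algHom_ext (.powers b) h2
    let y : τ ⊕ ι → D := fun j => g (ι₀ (π (MvPolynomial.X j)))
    have hy : ∀ q, MvPolynomial.aeval y q = g (ι₀ (π q)) := fun q => by
      have : MvPolynomial.aeval y = (g.comp ι₀).comp π := by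
        ext1 j
        simp [y]
      rw [this]
      rfl
    let u : ι → D := fun i => f (ι₀ (π (MvPolynomial.X (Sum.inr i)))) - y (Sum.inr i)
    have hu : ∀ i, u i ∈ I := fun i => by
      rw [← Ideal.Quotient.eq_zero_iff_mem, map_sub, sub_eq_zero]
      exact DFunLike.congr_fun hfg _
    have hshift : ∀ q, MvPolynomial.aeval (shift y 1 u) q = f (ι₀ (π q)) := fun q => by
      have : MvPolynomial.aeval (shift y 1 u) = (f.comp ι₀).comp π := by
        ext1 j
        rcases j with t | i
        · exact isEmptyElim t
        · simp [shift, u]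
      rw [this]
      rfl
    have hlin : ∀ i, ∑ l, MvPolynomial.aeval y (jacobian p i l) * u l = 0 := by
      intro i
      obtain ⟨R, hR, h⟩ := aeval_shift_sub_aeval_shift (p i) y 1 u 0 I I hu (by simp) (by simpa)
      have h0 : shift y 1 0 = y := by
        ext (t | i) <;> simp [shift]
      rw [← sq, hI] at hR
      rw [h0, hshift, hy, hp, (Submodule.mem_bot _).1 hR] at h
      simpa [jacobian] using h.symm
    have hu0 : ∀ i, u i = 0 := by
      intro i
      have h1 := sum_adjugate_mul_sum_jacobian p y u i
      simp only [hlin, mul_zero, Finset.sum_const_zero] at h1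
      rw [hy] at h1
      have h2 : IsUnit (g (ι₀ b)) := (IsLocalization.Away.algebraMap_isUnit b).map g
      exact h2.mul_right_eq_zero.1 h1.symm
    rintro (t | i)
    · exact isEmptyElim t
    · exact sub_eq_zero.1 (hu0 i)
  -- An unramified algebra of finite type over a field is finite, hence Artinian with discrete
  -- spectrum.
  have hC : Module.Finite k C := Algebra.FormallyUnramified.finite_of_free k C
  have hart : IsArtinianRing C := IsArtinianRing.of_finite k C
  have hemb := PrimeSpectrum.localization_away_isOpenEmbedding C b
  obtain ⟨y, rfl⟩ : x ∈ Set.range (PrimeSpectrum.comap (algebraMap B C)) := by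
    rw [PrimeSpectrum.localization_away_comap_range C b]
    exact hdet
  rw [← Set.image_singleton]
  exact hemb.isOpenMap _ (isOpen_discrete _)

end Presentation

/-! ### Affine charts -/

section Charts

variable {k : Type u} [Field k] {R : Type u} [CommRing R] [Algebra k R]

/-- The spectrum of a `k`-algebra as a scheme over `k`. -/
noncomputable abbrev specOver (k : Type u) [Field k] (R : Type u) [CommRing R] [Algebra k R] :
    Over (Spec (.of k)) :=
  (algSpec (.of k)).obj (.op (CommAlgCat.of k R))

/-- The morphism of spectra given by a morphism of `k`-algebras. -/
noncomputable def specMap {C D : CommAlgCat.{u} k} (φ : D ⟶ C) :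
   specOver k C ⟶ specOver k D := (algSpec (.of k)).map φ.op

theorem specMap_bijective (C D : CommAlgCat.{u} k) :
    Function.Bijective (specMap : (D ⟶ C) → (specOver k C ⟶ specOver k D)) := by
  constructor
  · intro φ ψ h
    exact Quiver.Hom.op_inj (algSpec.instFaithful (R := .of k) |>.map_injective h)
  · intro l
    obtain ⟨g, hg⟩ := (algSpec.instFull (R := .of k)).map_surjective (X := .op C) (Y := .op D) l
    exact ⟨g.unop, hg⟩

/-- The points of `X` given by those of an affine scheme over `X`. -/
noncomputable def homsToPoints {X : Over (Spec (.of k))} (j : specOver k R ⟶ X) :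
    homs R ⟶ points k X where
  app C := TypeCat.ofHom fun φ => specMap φ ≫ j
  naturality C D f := by
    ext φ
    change specMap (φ ≫ f) ≫ j = specMap f ≫ specMap φ ≫ j
    rw [specMap, op_comp, Functor.map_comp, Category.assoc]
    rfl

theorem homsToPoints_injective {X : Over (Spec (.of k))} (j : specOver k R ⟶ X)
    [Mono j] (C : CommAlgCat.{u} k) : Function.Injective ((homsToPoints j).app C) := by
  intro φ ψ h
  have h1 : specMap φ ≫ j = specMap ψ ≫ j := h
  exact (specMap_bijective C (CommAlgCat.of k R)).1 ((cancel_mono j).1 h1)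

/-- An open subset of the spectrum of a local ring that contains the closed point is everything, so
the whole morphism lands in the chart. -/
theorem exists_specMap_comp_eq {X : Over (Spec (.of k))} (j : specOver k R ⟶ X)
    [IsOpenImmersion j.left] {C : Type u} [CommRing C] [Algebra k C] [IsLocalRing C]
    (b : specOver k C ⟶ X)
    (hb : b.left (IsLocalRing.closedPoint C) ∈ Set.range j.left) :
    ∃ φ : CommAlgCat.of k R ⟶ CommAlgCat.of k C, specMap φ ≫ j = b := by
  have htop : b.left ⁻¹ᵁ j.left.opensRange = ⊤ :=
    Scheme.preimage_eq_top_of_closedPoint_mem (R := .of C) b.left hb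
  have hrange : Set.range b.left ⊆ Set.range j.left := by
    rintro _ ⟨x, rfl⟩
    exact htop.ge (Set.mem_univ x)
  have hl : IsOpenImmersion.lift j.left b.left hrange ≫ j.left = b.left :=
    IsOpenImmersion.lift_fac j.left b.left hrange
  obtain ⟨φ, hφ⟩ := (specMap_bijective (CommAlgCat.of k C) (CommAlgCat.of k R)).2
    (Over.homMk (IsOpenImmersion.lift j.left b.left hrange) (by
      rw [← Over.w j, ← Category.assoc, hl, Over.w b]))
  refine ⟨φ, ?_⟩
  rw [hφ]
  exact Over.OverMorphism.ext hl

theorem specMap_comp_left_closedPoint {X : Over (Spec (.of k))} {C D : Type u} [CommRing C]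
    [Algebra k C] [IsLocalRing C] [CommRing D] [Algebra k D] [IsLocalRing D] (f : D →ₐ[k] C)
    [IsLocalHom (f : D →+* C)] (b : specOver k D ⟶ X) :
    (specMap (CommAlgCat.ofHom f) ≫ b).left (IsLocalRing.closedPoint C) =
      b.left (IsLocalRing.closedPoint D) :=
  congrArg b.left (IsLocalRing.comap_closedPoint (f : D →+* C))

/-- The smooth locus is tested on stalk maps, whose source is a localization of k rather than k;
composing with that formally smooth localization gives the statement over k. -/
theorem formallySmooth_of_mem_smoothLocus (f : Spec (.of R) ⟶ Spec (.of k))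
    [LocallyOfFinitePresentation f] (hf : f = Spec.map (CommRingCat.ofHom (algebraMap k R)))
    (x : PrimeSpectrum R) (hx : (show Spec (.of R) from x) ∈ f.smoothLocus) :
    Algebra.FormallySmooth k (Localization.AtPrime x.asIdeal) := by
  subst hf
  have h1 := (RingHom.FormallySmooth.respectsIso.arrow_mk_iso_iff
    (Scheme.arrowStalkMapSpecIso (CommRingCat.ofHom (algebraMap k R)) x)).1
      (Scheme.Hom.mem_smoothLocus.1 hx)
  have h2 : (algebraMap k (Localization.AtPrime
      (PrimeSpectrum.comap (algebraMap k R) x).asIdeal)).FormallySmooth := by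
    rw [RingHom.formallySmooth_algebraMap]
    exact Algebra.FormallySmooth.of_isLocalization
      (PrimeSpectrum.comap (algebraMap k R) x).asIdeal.primeCompl
  have h3 := h2.comp h1
  rw [← RingHom.formallySmooth_algebraMap]
  have h4 : algebraMap k (Localization.AtPrime x.asIdeal) =
      (Localization.localRingHom (PrimeSpectrum.comap (algebraMap k R) x).asIdeal x.asIdeal
        (algebraMap k R) rfl).comp (algebraMap k _) := by
    refine RingHom.ext fun c => ?_
    exact (IsScalarTower.algebraMap_apply k R _ c).trans
      (Localization.localRingHom_to_map _ _ _ rfl _).symm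
  rw [h4]
  exact h3

theorem locallyOfFiniteType_specOver [h : Algebra.FiniteType k R] :
    LocallyOfFiniteType (specOver k R).hom :=
  (HasRingHomProperty.Spec_iff (P := @LocallyOfFiniteType)
    (φ := CommRingCat.ofHom (algebraMap k R))).2 (RingHom.finiteType_algebraMap.2 h)

theorem quasiCompact_specOver : QuasiCompact (specOver k R).hom := by
  change QuasiCompact (Spec.map (CommRingCat.ofHom (algebraMap k R)))
  infer_instance

end Charts

/-! ### Passage from the affine chart to X -/

/-- A product of functors to types respects isomorphisms of the second factor. -/
theorem nonempty_prod_iso {C : Type*} [Category C] (F : C ⥤ Type u) {G H : C ⥤ Type u}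
    (i : G ≅ H) : Nonempty (FunctorToTypes.prod F G ≅ FunctorToTypes.prod F H) := by
  refine nonempty_iso_of_relation (fun A a b => a.1 = b.1 ∧ i.hom.app A a.2 = b.2) ?_ ?_ ?_
  · rintro A B f ⟨a, a'⟩ ⟨b, b'⟩ ⟨rfl, rfl⟩
    exact ⟨rfl, NatTrans.naturality_apply i.hom f a'⟩
  · rintro A ⟨a, a'⟩
    exact ⟨(a, i.hom.app A a'), ⟨rfl, rfl⟩, fun b hb => Prod.ext hb.1.symm hb.2.symm⟩
  · rintro A ⟨b, b'⟩
    refine ⟨(b, i.inv.app A b'), ⟨rfl, by simp⟩, ?_⟩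
    rintro ⟨a, a'⟩ ⟨rfl, rfl⟩
    exact Prod.ext rfl (by simp)

theorem isLocalHom_mapReduction {k : Type u} [Field k] {A : Type u} [CommRing A] [Algebra k A]
    (hA : IsTestRing k A) : IsLocalHom (hA.mapReduction : PowerSeries A →+* PowerSeries k) :=
  ⟨fun _ h => hA.isUnit_of_mapReduction h⟩

theorem exists_formalNbhd_arcs_iso_diskPow_prod (k : Type u) [Field k] (X : Over (Spec (.of k)))
    [LocallyOfFiniteType X.hom] [QuasiCompact X.hom]
    (γ₀ : (arcs k X).obj (CommAlgCat.of k k))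
    (hsmooth : ¬ Set.range (arcHom γ₀) ⊆ (X.hom.smoothLocus : Set X.left)ᶜ)
    (hisolated : ¬ IsOpen ({arcOrigin γ₀} : Set X.left)) :
    ∃ (Y : Over (Spec (.of k))) (_ : LocallyOfFiniteType Y.hom) (_ : QuasiCompact Y.hom)
      (y : (points k Y).obj (CommAlgCat.of k k)),
      Nonempty (formalNbhd (arcs k X) γ₀ ≅
        FunctorToTypes.prod (diskPow k) (formalNbhd (points k Y) y)) := by
  obtain ⟨R, j, hj, hjx, -⟩ := Scheme.exists_affine_mem_range_and_range_subset
    (U := (⊤ : X.left.Opens)) (x := arcOrigin γ₀) trivial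
  let α : CommRingCat.of k ⟶ R := Spec.preimage (j ≫ X.hom)
  have hα : Spec.map α = j ≫ X.hom := Spec.map_preimage _
  let : Algebra k R := α.hom.toAlgebra
  let jO : specOver k R ⟶ X := Over.homMk j hα.symm
  have : IsOpenImmersion jO.left := hj
  have : Mono jO.left := inferInstance
  have : Mono jO := Over.mono_of_mono_left jO
  have hft : Algebra.FiniteType k R := by
    have h1 : LocallyOfFiniteType (Spec.map α) := by
      rw [hα]
      infer_instance
    exact (HasRingHomProperty.Spec_iff (P := @LocallyOfFiniteType)).1 h1
  obtain ⟨φ₀, hφ₀⟩ := exists_specMap_comp_eq jO (C := PowerSeries k) γ₀ hjx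
  have hleft : arcHom γ₀ = Spec.map (CommRingCat.ofHom φ₀.hom.toRingHom) ≫ j :=
    (congrArg CommaMorphism.left hφ₀).symm
  let η : Spec (.of (PowerSeries k)) := (⊥ : PrimeSpectrum (PowerSeries k))
  let x : PrimeSpectrum R := PrimeSpectrum.comap φ₀.hom.toRingHom ⊥
  have hη : arcHom γ₀ η = j x := by
    rw [hleft]
    rfl
  have hspec : ∀ s : Spec (.of (PowerSeries k)), arcHom γ₀ η ⤳ arcHom γ₀ s := fun s =>
    ((PrimeSpectrum.le_iff_specializes _ _).1 bot_le).map (arcHom γ₀).continuous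
  -- The generic point of the arc specialises to all its points, so it lies in every open set that
  -- the arc meets, in particular in the smooth locus.
  have hxs : Algebra.FormallySmooth k (Localization.AtPrime x.asIdeal) := by
    obtain ⟨_, ⟨s, rfl⟩, hs⟩ := Set.not_subset.1 hsmooth
    have h1 : arcHom γ₀ η ∈ X.hom.smoothLocus :=
      (hspec s).mem_open X.hom.smoothLocus.isOpen (not_not.1 hs)
    rw [hη] at h1
    refine formallySmooth_of_mem_smoothLocus (j ≫ X.hom) hα.symm x ?_
    rw [← Scheme.Hom.preimage_smoothLocus_eq]
    exact h1
  obtain ⟨τ, ι, _, _, _, p, π, h, hπ, hp, hh, hker, hdet⟩ :=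
    exists_presentation_of_formallySmooth (k := k) x.asIdeal
  have hmem : ∀ b : R, b ∉ x.asIdeal → φ₀.hom b ≠ 0 := fun b hb => hb
  -- With no free coordinate the image of the generic point is open; in a Jacobson space such a
  -- point is also closed, so it equals its specialisation γ₀(0), which would be isolated.
  have hτ : Nonempty τ := by
    by_contra hτ
    rw [not_nonempty_iff] at hτ
    have h1 : IsOpen {x} := isOpen_singleton_of_isEmpty hπ hp x hdet
    have h2 : IsOpen ({j x} : Set X.left) := by
      exact Set.image_singleton (f := j) (a := x) ▸ j.isOpenEmbedding.isOpenMap _ h1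
    have : JacobsonSpace X.left := LocallyOfFiniteType.jacobsonSpace X.hom
    have h3 : IsClosed ({j x} : Set X.left) :=
      isClosed_singleton_of_isLocallyClosed_singleton h2.isLocallyClosed
    have h4 : arcOrigin γ₀ = j x :=
      (hη ▸ hspec (IsLocalRing.closedPoint (PowerSeries k))).mem_closed h3 rfl
    exact hisolated (h4 ▸ h2)
  obtain ⟨D, _, _, hD, ρ₀, ⟨i⟩⟩ := exists_formalNbhd_arcs_iso (φ₀ := φ₀.hom) hπ hp (hmem _ hh) hker
    (hmem _ hdet)
  -- A deformation of γ₀ sends the closed point to γ₀(0), because the reduction of power series is a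
  -- local homomorphism; hence it factors through the chart.
  obtain ⟨i₁⟩ := nonempty_formalNbhd_iso (Functor.whiskerLeft (powerSeries k) (homsToPoints jO))
    (fun A => homsToPoints_injective jO _) φ₀ γ₀ hφ₀ fun A b hb => by
      have := A.property.isLocalRing
      have := isLocalHom_mapReduction A.property
      refine exists_specMap_comp_eq jO (C := PowerSeries A.obj) b ?_
      have h1 := specMap_comp_left_closedPoint A.property.mapReduction
        (show specOver k (PowerSeries A.obj) ⟶ X from b)
      have h2 : specMap (CommAlgCat.ofHom A.property.mapReduction) ≫
        (show specOver k (PowerSeries A.obj) ⟶ X from b) = γ₀ := hb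
      rw [h2] at h1
      exact h1 ▸ hjx
  obtain ⟨i₂⟩ := nonempty_formalNbhd_iso (homsToPoints (𝟙 (specOver k D)))
    (homsToPoints_injective _) (CommAlgCat.ofHom ρ₀) _ rfl fun A b _ => by
      obtain ⟨φ, hφ⟩ := (specMap_bijective A.obj (CommAlgCat.of k D)).2 b
      exact ⟨φ, (Category.comp_id _).trans hφ⟩
  obtain ⟨i₃⟩ := nonempty_prod_iso (diskPow k) i₂
  exact ⟨specOver k D, locallyOfFiniteType_specOver, quasiCompact_specOver, _,
    ⟨i₁.symm ≪≫ i ≪≫ i₃⟩⟩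

end FormalArc

theorem mainTheorem1 (k : Type u) [Field k] (X : Over (Spec (.of k)))
    [LocallyOfFiniteType X.hom] [QuasiCompact X.hom]
    (γ₀ : (FormalArc.arcs k X).obj (CommAlgCat.of k k))
    (hsmooth : ¬ Set.range (FormalArc.arcHom γ₀) ⊆ (X.hom.smoothLocus : Set X.left)ᶜ)
    (hisolated : ¬ IsOpen ({FormalArc.arcOrigin γ₀} : Set X.left)) :
    ∃ (Y : Over (Spec (.of k))) (_ : LocallyOfFiniteType Y.hom) (_ : QuasiCompact Y.hom)
      (y : (FormalArc.points k Y).obj (CommAlgCat.of k k)),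
      Nonempty (FormalArc.formalNbhd (FormalArc.arcs k X) γ₀ ≅
        FunctorToTypes.prod (FormalArc.diskPow k)
          (FormalArc.formalNbhd (FormalArc.points k Y) y)) := by
  exact FormalArc.exists_formalNbhd_arcs_iso_diskPow_prod k X γ₀ hsmooth hisolated
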